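/- Let $d\ge 1$, $\alpha>0$, and let $\nu$ be a finite Borel measure on the unit sphere $S^{d-1}\subset\mathbb{R}^d$ which is supported by finitely many distinct unit vectors $e^{(1)},\dots,e^{(l)}$, with $\nu_i=\nu(\{e^{(i)}\})>0$ for every $i$. Assume that the convex cone generated by $e^{(1)},\dots,e^{(l)}$ is all of $\mathbb{R}^d$. Let $\theta$ be the measure on $(0,\infty)$ with density $\alpha r^{-\alpha-1}$, and let $\pi=\pi_{\alpha,\nu}$ be a Poisson point process on $\mathbb{R}^d\setminus\{0\}$ whose intensity measure is the image of $\theta\times\nu$ under $(r,e)\mapsto re$. Let $\varsigma_1$ be the set of points of $\pi$, and for $k\ge 1$ let $C_k=C_k(\pi_{\alpha,\nu})$ be the convex hull of $\varsigma_k$ and $\varsigma_{k+1}=\varsigma_k\setminus \mathrm{ext}\,C_k$, where $\mathrm{ext}$ denotes the set of extreme points. Put $A=\{\nu_1^{1/\alpha}e^{(1)},\dots,\nu_l^{1/\alpha}e^{(l)}\}$ and let $C_\infty$ be the convex hull of $A$. If $A$ is extreme, that is, $A$ has at least $d+1$ elements and $\mathrm{ext}\,C_\infty=A$, then almost surely,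 as $k\to\infty$, $$d_H\left(k^{1/\alpha}C_k,\;C_\infty\right)=O\left(\sqrt{\frac{\ln\ln k}{k}}\right),$$ where $d_H$ is the Hausdorff distance. Moreover $C_\infty$ determines the limit shape of the peels: almost surely, $d_H\left(\rho_k^{-1}C_k,\;\rho_\infty^{-1}C_\infty\right)\to 0$ as $k\to\infty$, where $\rho_k=\max_{x\in C_k}|x|$ and $\rho_\infty=\max_{x\in C_\infty}|x|$. -/

import Mathlib

open MeasureTheory ProbabilityTheory Filter Metric Asymptotics
open scoped Pointwise Topology NNReal ENNReal

namespace Peeling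

/-- The measure on `ℝ`, carried by `(0, ∞)`, with density `r ↦ α r ^ (-α - 1)` there. -/
noncomputable def radialMeasure (α : ℝ) : Measure ℝ :=
  (volume.restrict (Set.Ioi 0)).withDensity fun r => ENNReal.ofReal (α * r ^ (-α - 1))

/-- The intensity `θ × ν`, the punctured space being identified with `(0, ∞) × S` through
`(r, e) ↦ r e`, where `S` is the unit sphere. -/
noncomputable def intensity {d : ℕ} (α : ℝ) (ν : Measure (sphere (0 : EuclideanSpace ℝ (Fin d)) 1)) :
    Measure (EuclideanSpace ℝ (Fin d)) :=
  ((radialMeasure α).prod ν).map fun p => p.1 • (p.2 : EuclideanSpace ℝ (Fin d))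

/-- A Poisson point process with (diffuse) intensity `μ`, given through its random set `π` of
points: `π` is countable, the number of points in a measurable set `B` is a random variable which
has the Poisson law with mean `μ B` (and is almost surely infinite if `μ B = ∞`), and the numbers
of points in disjoint measurable sets are independent. -/
structure IsPoissonPointProcess {E Ω : Type*} [MeasurableSpace E] [MeasurableSpace Ω]
    (μ : Measure E) (π : Ω → Set E) (P : Measure Ω) : Prop where
  countable : ∀ ω, (π ω).Countable
  measurable_count : ∀ B : Set E, MeasurableSet B → Measurable fun ω => (π ω ∩ B).encard
  poisson_count : ∀ B : Set E, MeasurableSet B → μ B ≠ ∞ →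
    ∀ n : ℕ, P {ω | (π ω ∩ B).encard = n} = poissonMeasure (μ B).toNNReal {n}
  infinite_count : ∀ B : Set E, MeasurableSet B → μ B = ∞ → ∀ᵐ ω ∂P, (π ω ∩ B).encard = ⊤
  independent_count : ∀ (n : ℕ) (B : Fin n → Set E), (∀ i, MeasurableSet (B i)) →
    Pairwise (fun i j => Disjoint (B i) (B j)) → iIndepFun (fun i ω => (π ω ∩ B i).encard) P

/-- What is left of `S` after `n` steps of peeling; each step removes the extreme points of the
convex hull of the current set. -/
def remaining {E : Type*} [AddCommGroup E] [Module ℝ E] (S : Set E) : ℕ → Set E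
  | 0 => S
  | n + 1 => remaining S n \ (convexHull ℝ (remaining S n)).extremePoints ℝ

/-- The `k`-th convex hull (peel) of `S`, for `k = 1, 2, …`; so `peel S 1 = convexHull ℝ S`. The
value at `k = 0` plays no role. -/
def peel {E : Type*} [AddCommGroup E] [Module ℝ E] (S : Set E) (k : ℕ) : Set E :=
  convexHull ℝ (remaining S (k - 1))

/-- A finite set of at least `d + 1` points of `ℝ^d` that is the set of extreme points of its
convex hull. -/
def IsExtremeSet {d : ℕ} (A : Set (EuclideanSpace ℝ (Fin d))) : Prop :=
  A.Finite ∧ d + 1 ≤ A.ncard ∧ (convexHull ℝ A).extremePoints ℝ = A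

/-- The set of the points `ν_i ^ (1 / α) e_i`, where `ν_i` is the mass of the atom `e_i`. -/
noncomputable def scaledAtoms {d l : ℕ} (α : ℝ)
    (ν : Measure (sphere (0 : EuclideanSpace ℝ (Fin d)) 1))
    (e : Fin l → sphere (0 : EuclideanSpace ℝ (Fin d)) 1) : Set (EuclideanSpace ℝ (Fin d)) :=
  Set.range fun i => (ν.real {e i}) ^ (1 / α) • (e i : EuclideanSpace ℝ (Fin d))

/-- The largest norm of a point of `C`. -/
noncomputable def radius {E : Type*} [NormedAddCommGroup E] (C : Set E) : ℝ :=
  sSup (norm '' C)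

/-- `C` rescaled so that the largest norm of a point becomes `1`. -/
noncomputable def normalize {E : Type*} [NormedAddCommGroup E] [NormedSpace ℝ E] (C : Set E) :
    Set E :=
  (radius C)⁻¹ • C

/-- The (non-random) set `K` is the limit shape of the random sets `C 1, C 2, …`: after
normalization these converge to `K` almost surely in the Hausdorff distance. -/
def IsLimitShape {E Ω : Type*} [NormedAddCommGroup E] [NormedSpace ℝ E] [MeasurableSpace Ω]
    (P : Measure Ω) (C : ℕ → Ω → Set E) (K : Set E) : Prop :=
  ∀ᵐ ω ∂P, Tendsto (fun k => hausdorffEDist (normalize (C k ω)) K) atTop (𝓝 0)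

end Peeling

/-!
Almost surely all points of the process lie on the `l` rays spanned by the atoms `e i`. On the ray
of `e i`, whose atom has mass `v i`, the coordinate `x ↦ v i * ‖x‖ ^ (-α)` turns the points into a
Poisson process of rate `1` on `(0, ∞)`. If `Γ i 0 < Γ i 1 < …` are its points, then the points of
the original process on this ray are `Γ i n ^ (-1 / α) • a i`, where `a i = v i ^ (1 / α) • e i` is
an element of the set `A` of scaled atoms.

*Peeling is deterministic up to a bounded delay.* Since the rays generate the whole space, the
origin is in the convex hull of any choice of one point per ray. Hence only the farthest remaining
point of a ray can be extreme, and a step of peeling removes at most one point of each ray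
(`remaining_range_eq_rayTail`). The remaining point of largest norm is always extreme, so no ray is
ignored forever (`exists_forall_le_peelIndex`). Since `A` is extreme, each `a i` is strictly
separated from the other points of `A` and the origin, so that `s i • a i` is an extreme point of
the hull of the `s j • a j` as soon as `s i > q * s j` for all `j`, with some fixed `q < 1`
(`exists_forall_smul_mem_extremePoints`). As `Γ i n / Γ j n → 1`, the rays that have lost the fewest
points lose one in each step from some time on. Therefore the number of points that the ray of `a i`
has lost after `k` steps lies between `k - K` and `k`, with `K` not depending on `k`
(`exists_le_peelIndex_add`).

*Rate.* By the law of the iterated logarithm, `Γ i n = n + O(√(n log log n))`. The proof applies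
Doob's maximal inequality to the exponential submartingale of centred Poisson counts on dyadic
blocks, followed by the Borel–Cantelli lemma (`ae_poisson_sum_isBigO`). So the vertices of the
`k`-th peel, multiplied by `k ^ (1 / α)`, are at distance `O(√(log log k / k))` from the `a i`, and
the Hausdorff distance of two polytopes is at most the largest distance of corresponding vertices
(`hausdorffEDist_convexHull_range_le`). The limit shape follows, because normalizing the convex hull
of a family of points amounts to dividing the family by its supremum norm.
-/

namespace Peeling

/-! ### A law of the iterated logarithm for Poisson sums -/

section Poisson

variable {Ω : Type*} [MeasurableSpace Ω] {P : Measure Ω}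

theorem hasSum_exp_mul_poisson (t : ℝ) :
    HasSum (fun n : ℕ => Real.exp (-(1 : ℝ≥0)) * ((1 : ℝ≥0) : ℝ) ^ n / n.factorial *
      Real.exp (t * (n - 1))) (Real.exp (Real.exp t - 1 - t)) := by
  have h := (NormedSpace.expSeries_div_hasSum_exp (Real.exp t)).mul_left (Real.exp (-1 - t))
  rw [← Real.exp_eq_exp_ℝ, ← Real.exp_add] at h
  have hterm : (fun n : ℕ => Real.exp (-(1 : ℝ≥0)) * ((1 : ℝ≥0) : ℝ) ^ n / n.factorial *
      Real.exp (t * (n - 1))) =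
      fun n : ℕ => Real.exp (-1 - t) * (Real.exp t ^ n / n.factorial) := by
    ext n
    have : Real.exp (t * (n - 1)) = Real.exp t ^ n * Real.exp (-t) := by
      rw [← Real.exp_nat_mul, ← Real.exp_add]; ring_nf
    rw [this, show (-1 - t : ℝ) = -1 + -t by ring, Real.exp_add]
    simp only [NNReal.coe_one, one_pow, mul_one]
    ring
  rw [hterm, show Real.exp t - 1 - t = -1 - t + Real.exp t by ring]
  exact h

theorem integrable_exp_mul_of_poisson {Y : Ω → ℕ} (hY : Measurable Y)
    (hlaw : P.map Y = poissonMeasure 1) (t : ℝ) :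
    Integrable (fun ω => Real.exp (t * ((Y ω : ℝ) - 1))) P := by
  have : Integrable (fun n : ℕ => Real.exp (t * ((n : ℝ) - 1))) (P.map Y) := by
    rw [hlaw, integrable_poissonMeasure_iff]
    simpa only [Real.norm_eq_abs, Real.abs_exp] using (hasSum_exp_mul_poisson t).summable
  exact this.comp_measurable hY

theorem integral_exp_mul_of_poisson {Y : Ω → ℕ} (hY : Measurable Y)
    (hlaw : P.map Y = poissonMeasure 1) (t : ℝ) :
    ∫ ω, Real.exp (t * ((Y ω : ℝ) - 1)) ∂P = Real.exp (Real.exp t - 1 - t) := by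
  have := integral_map (μ := P) hY.aemeasurable
    (f := fun n : ℕ => Real.exp (t * ((n : ℝ) - 1))) (by fun_prop)
  rw [← this, hlaw, integral_poissonMeasure]
  simpa only [smul_eq_mul] using (hasSum_exp_mul_poisson t).tsum_eq

variable [IsProbabilityMeasure P]

theorem integrable_prod_of_iIndepFun {g : ℕ → Ω → ℝ} (hg : iIndepFun g P)
    (hm : ∀ i, Measurable (g i)) (hint : ∀ i, Integrable (g i) P) (n : ℕ) :
    Integrable (∏ i ∈ Finset.range n, g i) P := by
  induction n with
  | zero =>
    rw [Finset.range_zero, Finset.prod_empty]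
    exact integrable_const (1 : ℝ)
  | succ n ih =>
    rw [Finset.prod_range_succ]
    exact (hg.indepFun_prod_range_succ hm n).integrable_mul ih (hint n)

/-- Partial products of independent nonnegative variables of mean at least `1` form a submartingale. -/
theorem submartingale_prod_of_iIndepFun {g : ℕ → Ω → ℝ} (hg : iIndepFun g P)
    (hm : ∀ i, Measurable (g i)) (hint : ∀ i, Integrable (g i) P) (hpos : ∀ i ω, 0 ≤ g i ω)
    (hmean : ∀ i, 1 ≤ ∫ ω, g i ω ∂P) :
    Submartingale (fun n => ∏ i ∈ Finset.range (n + 1), g i)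
      (Filtration.natural g fun i => (hm i).stronglyMeasurable) P := by
  have hadp : StronglyAdapted (Filtration.natural g fun i => (hm i).stronglyMeasurable)
      (fun n => ∏ i ∈ Finset.range (n + 1), g i) := by
    intro n
    refine Finset.stronglyMeasurable_prod _ fun i hi => ?_
    exact ((Filtration.stronglyAdapted_natural fun i => (hm i).stronglyMeasurable) i).mono
      (Filtration.mono _ (Nat.lt_succ_iff.1 (Finset.mem_range.1 hi)))
  refine submartingale_nat hadp (fun n => integrable_prod_of_iIndepFun hg hm hint _) fun n => ?_
  have h1 := condExp_mul_of_stronglyMeasurable_left (μ := P) (hadp n) (g := g (n + 1))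
    (by rw [← Finset.prod_range_succ]; exact integrable_prod_of_iIndepFun hg hm hint _)
    (hint _)
  have h2 := hg.condExp_natural_ae_eq_of_lt (fun i => (hm i).stronglyMeasurable)
    (Nat.lt_succ_self n)
  have h3 : (∏ i ∈ Finset.range (n + 1 + 1), g i) =
    (∏ i ∈ Finset.range (n + 1), g i) * g (n + 1) := Finset.prod_range_succ _ _
  filter_upwards [h1, h2] with ω h1 h2
  rw [h3, h1, Pi.mul_apply, h2]
  have : 0 ≤ (∏ i ∈ Finset.range (n + 1), g i) ω := by
    rw [Finset.prod_apply]; exact Finset.prod_nonneg fun i _ => hpos i ω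
  nlinarith [hmean (n + 1)]

/-- Chernoff bound for the running maximum of centred Poisson sums, from Doob's maximal inequality
for the submartingale `exp (t * S n)` and `exp t - 1 - t ≤ t ^ 2` for `|t| ≤ 1`. -/
theorem measure_exists_le_poisson_sum_le {Y : ℕ → Ω → ℕ} (hind : iIndepFun Y P)
    (hY : ∀ i, Measurable (Y i)) (hlaw : ∀ i, P.map (Y i) = poissonMeasure 1)
    {t : ℝ} (ht : |t| ≤ 1) (y : ℝ) (N : ℕ) :
    P {ω | ∃ n ≤ N, y ≤ t * ∑ i ∈ Finset.range (n + 1), ((Y i ω : ℝ) - 1)} ≤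
      ENNReal.ofReal (Real.exp (t ^ 2 * (N + 1) - y)) := by
  set g : ℕ → Ω → ℝ := fun i ω => Real.exp (t * ((Y i ω : ℝ) - 1)) with hg
  have hgi : iIndepFun g P :=
    hind.comp (fun _ n => Real.exp (t * ((n : ℝ) - 1))) fun _ => .of_discrete
  have hgm : ∀ i, Measurable (g i) := fun i =>
    (Measurable.of_discrete (f := fun n : ℕ => Real.exp (t * ((n : ℝ) - 1)))).comp (hY i)
  have hint : ∀ i, Integrable (g i) P := fun i => integrable_exp_mul_of_poisson (hY i) (hlaw i) t
  have hmean : ∀ i, ∫ ω, g i ω ∂P = Real.exp (Real.exp t - 1 - t) := fun i =>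
    integral_exp_mul_of_poisson (hY i) (hlaw i) t
  have hpos : ∀ i ω, 0 ≤ g i ω := fun i ω => (Real.exp_pos _).le
  have hsub := submartingale_prod_of_iIndepFun hgi hgm hint hpos fun i => by
    rw [hmean]; exact Real.one_le_exp (by linarith [Real.add_one_le_exp t])
  have hprod : ∀ n ω, (∏ i ∈ Finset.range n, g i) ω =
      Real.exp (t * ∑ i ∈ Finset.range n, ((Y i ω : ℝ) - 1)) := fun n ω => by
    rw [Finset.prod_apply, Finset.mul_sum, Real.exp_sum]
  have hint_eq : ∀ n, ∫ ω, (∏ i ∈ Finset.range n, g i) ω ∂P =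
      Real.exp (n * (Real.exp t - 1 - t)) := by
    intro n
    induction n with
    | zero => simp
    | succ n ih =>
      rw [Finset.prod_range_succ, (hgi.indepFun_prod_range_succ hgm n).integral_mul_eq_mul_integral
        (integrable_prod_of_iIndepFun hgi hgm hint n).aestronglyMeasurable
        (hint n).aestronglyMeasurable, ih, hmean, ← Real.exp_add]
      push_cast; ring_nf
  have hnonneg : (0 : ℕ → Ω → ℝ) ≤ fun n => ∏ i ∈ Finset.range (n + 1), g i := fun n ω =>
    (Real.exp_pos _).le.trans_eq (hprod _ _).symm
  obtain ⟨ε, hε⟩ : ∃ ε : ℝ≥0, (ε : ℝ) = Real.exp y := ⟨⟨_, (Real.exp_pos y).le⟩, rfl⟩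
  have hmax := maximal_ineq hsub hnonneg (ε := ε) N
  set A := {ω | ∃ n ≤ N, y ≤ t * ∑ i ∈ Finset.range (n + 1), ((Y i ω : ℝ) - 1)}
  have hA : {ω | (ε : ℝ) ≤
      (Finset.range (N + 1)).sup' Finset.nonempty_range_add_one
        fun k => (∏ i ∈ Finset.range (k + 1), g i) ω} = A := by
    ext ω
    simp only [A, Set.mem_ofPred_eq, Finset.le_sup'_iff, Finset.mem_range, Nat.lt_succ_iff, hprod,
      hε, Real.exp_le_exp]
  rw [hA] at hmax
  have hle : ∫ ω in A, (∏ i ∈ Finset.range (N + 1), g i) ω ∂P ≤ Real.exp (t ^ 2 * (N + 1)) := by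
    refine (setIntegral_le_integral (integrable_prod_of_iIndepFun hgi hgm hint _)
      (ae_of_all _ fun ω => hnonneg N ω)).trans ?_
    rw [hint_eq]
    refine Real.exp_le_exp.2 ?_
    have h1 := (abs_le.1 (Real.abs_exp_sub_one_sub_id_le ht)).2
    push_cast
    nlinarith [(Nat.cast_nonneg N : (0 : ℝ) ≤ N)]
  have hfin := hmax.trans (ENNReal.ofReal_le_ofReal hle)
  have he : (ε : ℝ≥0∞) = ENNReal.ofReal (Real.exp y) := by
    rw [← hε, ENNReal.ofReal_coe_nnreal]
  rw [he] at hfin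
  rw [Real.exp_sub, ENNReal.ofReal_div_of_pos (Real.exp_pos y)]
  rw [ENNReal.le_div_iff_mul_le (Or.inl (by simp [Real.exp_pos])) (Or.inl ENNReal.ofReal_ne_top),
    mul_comm]
  exact hfin

end Poisson

/-- The scale `√(x log log x)` of the fluctuations in the law of the iterated logarithm. -/
noncomputable def lilScale (x : ℝ) : ℝ := √(x * Real.log (Real.log x))

section Poisson

variable {Ω : Type*} [MeasurableSpace Ω] {P : Measure Ω} [IsProbabilityMeasure P]

/-- The sign of `t m = ± √(log m / 2 ^ m)` is left open, to bound the centred sums from both sides.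
The threshold `3 log m` makes the `m`-th exceptional event have probability at most `m ^ (-2)`. -/
theorem ae_eventually_forall_mul_poisson_sum_lt {Y : ℕ → Ω → ℕ} (hind : iIndepFun Y P)
    (hY : ∀ i, Measurable (Y i)) (hlaw : ∀ i, P.map (Y i) = poissonMeasure 1)
    {t : ℕ → ℝ} (ht : ∀ m : ℕ, t m ^ 2 = Real.log m / 2 ^ m) :
    ∀ᵐ ω ∂P, ∀ᶠ m : ℕ in atTop, ∀ n, 0 < n → n ≤ 2 ^ m →
      t m * ∑ i ∈ Finset.range n, ((Y i ω : ℝ) - 1) < 3 * Real.log m := by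
  have hsum : ∑' m : ℕ, P {ω | ∃ n ≤ 2 ^ m - 1, 3 * Real.log m ≤
      t m * ∑ i ∈ Finset.range (n + 1), ((Y i ω : ℝ) - 1)} ≠ ∞ := by
    have hle : ∀ m : ℕ, P {ω | ∃ n ≤ 2 ^ m - 1, 3 * Real.log m ≤
        t m * ∑ i ∈ Finset.range (n + 1), ((Y i ω : ℝ) - 1)} ≤
        ENNReal.ofReal (if m = 0 then 1 else 1 / (m : ℝ) ^ 2) := by
      intro m
      rcases Nat.eq_zero_or_pos m with rfl | hm
      · simpa using prob_le_one
      have hm' : (0 : ℝ) < m := by exact_mod_cast hm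
      have ht1 : |t m| ≤ 1 := by
        rw [← sq_le_one_iff_abs_le_one, ht, div_le_one (by positivity)]
        have h1 : (m : ℝ) ≤ 2 ^ m := by exact_mod_cast (Nat.lt_two_pow_self (n := m)).le
        linarith [Real.log_le_sub_one_of_pos hm']
      refine (measure_exists_le_poisson_sum_le hind hY hlaw ht1 _ _).trans_eq ?_
      rw [if_neg hm.ne', Nat.cast_sub Nat.one_le_two_pow, ht]
      push_cast
      rw [sub_add_cancel, div_mul_cancel₀ _ (by positivity),
        show Real.log m - 3 * Real.log m = -(2 * Real.log m) by ring, Real.exp_neg, one_div,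
        show (2 : ℝ) * Real.log m = (2 : ℕ) * Real.log m by norm_num, Real.exp_nat_mul,
        Real.exp_log hm']
    refine ne_top_of_le_ne_top ?_ (ENNReal.tsum_le_tsum hle)
    refine Summable.tsum_ofReal_ne_top ?_
    refine (summable_congr_atTop ?_).1 (Real.summable_one_div_nat_pow.2 one_lt_two)
    filter_upwards [eventually_gt_atTop 0] with m hm
    rw [if_neg hm.ne']
  filter_upwards [ae_eventually_notMem hsum] with ω hω
  filter_upwards [hω] with m hm n hn hnm
  by_contra! hcon
  exact hm ⟨n - 1, by omega, by rwa [Nat.sub_add_cancel hn]⟩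

/-- The `O`-part of the **law of the iterated logarithm** for independent Poisson variables of
mean `1`. -/
theorem ae_poisson_sum_isBigO {Y : ℕ → Ω → ℕ} (hind : iIndepFun Y P)
    (hY : ∀ i, Measurable (Y i)) (hlaw : ∀ i, P.map (Y i) = poissonMeasure 1) :
    ∀ᵐ ω ∂P, (fun n : ℕ => (∑ i ∈ Finset.range n, (Y i ω : ℝ)) - n)
      =O[atTop] fun n : ℕ => lilScale n := by
  have hs : ∀ m : ℕ, √(Real.log m / 2 ^ m) ^ 2 = Real.log m / 2 ^ m := fun m =>
    Real.sq_sqrt (div_nonneg (Real.log_natCast_nonneg m) (by positivity))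
  filter_upwards [ae_eventually_forall_mul_poisson_sum_lt hind hY hlaw hs,
    ae_eventually_forall_mul_poisson_sum_lt hind hY hlaw
      (t := fun m => -√(Real.log m / 2 ^ m)) (fun m => by rw [neg_sq]; exact hs m)] with ω h1 h2
  obtain ⟨m₀, hm₀⟩ := eventually_atTop.1 (h1.and h2)
  have hlog : Tendsto (fun n : ℕ => Real.log n) atTop atTop :=
    Real.tendsto_log_atTop.comp tendsto_natCast_atTop_atTop
  refine IsBigO.of_bound 6 ?_
  filter_upwards [hlog.eventually_ge_atTop 3, eventually_ge_atTop (2 ^ (m₀ + 1))] with n hn3 hn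
  have hn0 : 0 < n := lt_of_lt_of_le (by positivity) hn
  have hn0' : (0 : ℝ) < n := by exact_mod_cast hn0
  -- the dyadic block `2 ^ (m - 1) ≤ n < 2 ^ m`
  obtain ⟨m, hm⟩ : ∃ m, m = Nat.log 2 n + 1 := ⟨_, rfl⟩
  have hnm : n < 2 ^ m := hm ▸ Nat.lt_pow_succ_log_self one_lt_two n
  have hpow : 2 ^ Nat.log 2 n ≤ n := Nat.pow_log_le_self 2 hn0.ne'
  have hmm₀ : m₀ + 1 ≤ Nat.log 2 n := Nat.le_log_of_pow_le one_lt_two hn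
  obtain ⟨h1, h2⟩ := hm₀ m (by omega)
  have h1 := h1 n hn0 hnm.le
  have h2 := h2 n hn0 hnm.le
  have hm2 : (2 : ℝ) ≤ m := by exact_mod_cast (by omega : 2 ≤ m)
  have hlm : 0 < Real.log m := Real.log_pos (by linarith)
  have h2m : (2 : ℝ) ^ m ≤ 2 * n := by
    rw [hm, pow_succ]; have : (2 : ℝ) ^ Nat.log 2 n ≤ n := by exact_mod_cast hpow
    linarith
  have hmlog : (m : ℝ) ≤ Real.log n ^ 2 := by
    have h3 : Nat.log 2 n * Real.log 2 ≤ Real.log n := by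
      rw [← Real.log_pow]
      exact Real.log_le_log (by positivity) (by exact_mod_cast hpow)
    have h4 := Real.log_two_gt_d9
    have h5 : (m : ℝ) = Nat.log 2 n + 1 := by rw [hm]; push_cast; rfl
    nlinarith [(Nat.cast_nonneg (Nat.log 2 n) : (0 : ℝ) ≤ Nat.log 2 n)]
  have hll : Real.log m ≤ 2 * Real.log (Real.log n) := by
    refine (Real.log_le_log (by linarith) hmlog).trans_eq ?_
    rw [Real.log_pow]; norm_num
  have hspos : 0 < √(Real.log m / 2 ^ m) := Real.sqrt_pos.2 (by positivity)
  have hS : (∑ i ∈ Finset.range n, ((Y i ω : ℝ) - 1)) =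
      (∑ i ∈ Finset.range n, (Y i ω : ℝ)) - n := by
    rw [Finset.sum_sub_distrib]; simp
  rw [hS] at h1 h2
  set S := (∑ i ∈ Finset.range n, (Y i ω : ℝ)) - n
  have hkey : √(Real.log m / 2 ^ m) * √(Real.log m * 2 ^ m) = Real.log m := by
    rw [← Real.sqrt_mul (by positivity), show Real.log m / 2 ^ m * (Real.log m * 2 ^ m) =
      Real.log m ^ 2 by field_simp, Real.sqrt_sq hlm.le]
  have hSle : |S| ≤ 3 * √(Real.log m * 2 ^ m) := by
    rw [abs_le]
    constructor <;> nlinarith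
  rw [Real.norm_eq_abs, Real.norm_eq_abs, lilScale, abs_of_nonneg (Real.sqrt_nonneg _)]
  refine hSle.trans ?_
  have : √(Real.log m * 2 ^ m) ≤ √(2 ^ 2 * (n * Real.log (Real.log n))) := by
    refine Real.sqrt_le_sqrt ?_
    calc Real.log m * 2 ^ m ≤ (2 * Real.log (Real.log n)) * (2 * n) :=
          mul_le_mul hll h2m (by positivity) (by linarith)
      _ = _ := by ring
  rw [Real.sqrt_mul (by norm_num : (0 : ℝ) ≤ 2 ^ 2), Real.sqrt_sq (by norm_num)] at this
  linarith

end Poisson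

/-! ### Peeling of points on finitely many rays -/

section Rays

variable {E ι : Type*} [NormedAddCommGroup E] [InnerProductSpace ℝ E]

/-- If a linear functional takes its largest value on the family `y` only at `y i`, then `y i` is an
extreme point of the convex hull. -/
theorem mem_extremePoints_convexHull_range {y : ι → E} {i : ι} (f : E →ₗ[ℝ] ℝ)
    (hf : ∀ j, j ≠ i → f (y j) < f (y i)) :
    y i ∈ (convexHull ℝ (Set.range y)).extremePoints ℝ := by
  -- the hull lies in the convex set made of `y i` and an open half-space
  have hsub : convexHull ℝ (Set.range y) ⊆ {x | x = y i ∨ f x < f (y i)} := by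
    refine convexHull_min ?_ ?_
    · rintro _ ⟨j, rfl⟩
      by_cases h : j = i
      · exact Or.inl (by rw [h])
      · exact Or.inr (hf j h)
    · rw [convex_iff_forall_pos]
      rintro x hx z hz s t hs ht hst
      rcases hx with rfl | hx <;> rcases hz with rfl | hz
      · left; rw [← add_smul, hst, one_smul]
      all_goals
        right
        simp only [map_add, map_smul, smul_eq_mul]
        have : t = 1 - s := by linarith
        subst this
        nlinarith
  refine mem_extremePoints.2 ⟨subset_convexHull ℝ _ ⟨i, rfl⟩, fun x hx z hz hxz => ?_⟩
  obtain ⟨s, t, hs, ht, hst, h⟩ := hxz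
  have hfx : s * f x + t * f z = f (y i) := by rw [← h]; simp
  have ht' : t = 1 - s := by linarith
  subst ht'
  have hle : ∀ w ∈ convexHull ℝ (Set.range y), f w ≤ f (y i) := fun w hw => by
    rcases hsub hw with rfl | h
    exacts [le_rfl, h.le]
  constructor
  · rcases hsub hx with h | h
    · exact h
    · have := hle z hz; nlinarith
  · rcases hsub hz with h | h
    · exact h
    · have := hle x hx; nlinarith

/-- A point of largest norm is extreme, because the Euclidean ball is strictly convex. -/
theorem mem_extremePoints_convexHull_range_of_norm_le {y : ι → E} (hy : Function.Injective y)
    {i : ι} (hi : ∀ j, ‖y j‖ ≤ ‖y i‖) :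
    y i ∈ (convexHull ℝ (Set.range y)).extremePoints ℝ := by
  refine mem_extremePoints_convexHull_range (innerₗ E (y i)) fun j hj => ?_
  have h1 : 0 < ‖y i - y j‖ := norm_pos_iff.2 (sub_ne_zero.2 fun h => hj (hy h).symm)
  have h2 := norm_sub_sq_real (y i) (y j)
  have h3 := hi j
  simp only [innerₗ_apply_apply, real_inner_self_eq_norm_sq]
  nlinarith [norm_nonneg (y j), pow_pos h1 2]

/-- The points on the rays spanned by the `a i` whose index is at least `c i`; the `n`-th point on
the ray of `a i` is `g i n • a i`. -/
def rayTail (a : ι → E) (g : ι → ℕ → ℝ) (c : ι → ℕ) : Set E :=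
  {x | ∃ i n, c i ≤ n ∧ g i n • a i = x}

variable {a : ι → E} {g : ι → ℕ → ℝ}

theorem zero_mem_convexHull_range_smul [Fintype ι] [Nonempty ι] {w : ι → ℝ} (hw : ∀ i, 0 < w i)
    (hwa : ∑ i, w i • a i = 0) {s : ι → ℝ} (hs : ∀ i, 0 < s i) :
    (0 : E) ∈ convexHull ℝ (Set.range fun i => s i • a i) := by
  have hW : 0 < ∑ i, w i / s i :=
    Finset.sum_pos (fun i _ => div_pos (hw i) (hs i)) Finset.univ_nonempty
  have := (convex_convexHull ℝ (Set.range fun i => s i • a i)).sum_mem (t := Finset.univ)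
    (w := fun i => (w i / s i) / ∑ i, w i / s i) (z := fun i => s i • a i)
    (fun i _ => (div_pos (div_pos (hw i) (hs i)) hW).le)
    (by rw [← Finset.sum_div, div_self hW.ne']) (fun i _ => subset_convexHull ℝ _ ⟨i, rfl⟩)
  convert this using 1
  have h : ∀ i, ((w i / s i) / ∑ i, w i / s i) • s i • a i =
      (∑ i, w i / s i)⁻¹ • w i • a i := fun i => by
    rw [smul_smul, smul_smul]; congr 1; have := (hs i).ne'; field_simp
  simp only [h, ← Finset.smul_sum, hwa, smul_zero]

theorem convexHull_rayTail [Fintype ι] [Nonempty ι] {w : ι → ℝ} (hw : ∀ i, 0 < w i)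
    (hwa : ∑ i, w i • a i = 0) (hpos : ∀ i n, 0 < g i n) (hanti : ∀ i, StrictAnti (g i))
    (c : ι → ℕ) :
    convexHull ℝ (rayTail a g c) = convexHull ℝ (Set.range fun i => g i (c i) • a i) := by
  refine Set.Subset.antisymm (convexHull_min ?_ (convex_convexHull ℝ _)) (convexHull_mono ?_)
  · rintro _ ⟨i, n, hn, rfl⟩
    have h0 := zero_mem_convexHull_range_smul hw hwa fun i => hpos i (c i)
    have := (convex_convexHull ℝ _).smul_mem_of_zero_mem h0
      (subset_convexHull ℝ (Set.range fun i => g i (c i) • a i) ⟨i, rfl⟩)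
      (t := g i n / g i (c i)) ⟨(div_pos (hpos _ _) (hpos _ _)).le,
        (div_le_one (hpos _ _)).2 ((hanti i).antitone hn)⟩
    rwa [smul_smul, div_mul_cancel₀ _ (hpos _ _).ne'] at this
  · rintro _ ⟨i, rfl⟩
    exact ⟨i, c i, le_rfl, rfl⟩

open Classical in
/-- The number of points that `k` steps of peeling remove from each ray. -/
noncomputable def peelIndex (a : ι → E) (g : ι → ℕ → ℝ) : ℕ → ι → ℕ
  | 0 => 0
  | k + 1 => fun i => peelIndex a g k i +
      if g i (peelIndex a g k i) • a i ∈
        (convexHull ℝ (Set.range fun j => g j (peelIndex a g k j) • a j)).extremePoints ℝ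
      then 1 else 0

theorem peelIndex_le_succ (k : ℕ) (i : ι) : peelIndex a g k i ≤ peelIndex a g (k + 1) i :=
  Nat.le_add_right _ _

theorem peelIndex_succ_of_mem {k : ℕ} {i : ι} (h : g i (peelIndex a g k i) • a i ∈
    (convexHull ℝ (Set.range fun j => g j (peelIndex a g k j) • a j)).extremePoints ℝ) :
    peelIndex a g (k + 1) i = peelIndex a g k i + 1 :=
  congrArg (peelIndex a g k i + ·) (if_pos h)

theorem peelIndex_succ_of_notMem {k : ℕ} {i : ι} (h : g i (peelIndex a g k i) • a i ∉
    (convexHull ℝ (Set.range fun j => g j (peelIndex a g k j) • a j)).extremePoints ℝ) :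
    peelIndex a g (k + 1) i = peelIndex a g k i :=
  congrArg (peelIndex a g k i + ·) (if_neg h)

theorem peelIndex_succ_le (k : ℕ) (i : ι) : peelIndex a g (k + 1) i ≤ peelIndex a g k i + 1 := by
  refine Nat.add_le_add_left ?_ _
  split_ifs <;> omega

theorem peelIndex_le (k : ℕ) (i : ι) : peelIndex a g k i ≤ k := by
  induction k with
  | zero => exact le_rfl
  | succ k ih => exact (peelIndex_succ_le k i).trans (Nat.succ_le_succ ih)

/-- Peeling removes at most the farthest point of each ray. -/
theorem remaining_range_eq_rayTail [Fintype ι] [Nonempty ι] {w : ι → ℝ} (hw : ∀ i, 0 < w i)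
    (hwa : ∑ i, w i • a i = 0) (hpos : ∀ i n, 0 < g i n) (hanti : ∀ i, StrictAnti (g i))
    (hinj : Function.Injective fun p : ι × ℕ => g p.1 p.2 • a p.1) (k : ℕ) :
    remaining (Set.range fun p : ι × ℕ => g p.1 p.2 • a p.1) k =
      rayTail a g (peelIndex a g k) := by
  induction k with
  | zero =>
    ext x
    simp [remaining, rayTail, peelIndex]
  | succ k ih =>
    rw [remaining, ih, convexHull_rayTail hw hwa hpos hanti]
    ext x
    constructor
    · rintro ⟨⟨i, n, hn, rfl⟩, hx⟩
      refine ⟨i, n, ?_, rfl⟩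
      rcases hn.eq_or_lt with h | h
      · rw [peelIndex_succ_of_notMem (by rwa [h])]; exact hn
      · exact (peelIndex_succ_le k i).trans h
    · rintro ⟨i, n, hn, rfl⟩
      refine ⟨⟨i, n, (peelIndex_le_succ k i).trans hn, rfl⟩, fun hx => ?_⟩
      obtain ⟨j, hj⟩ := extremePoints_convexHull_subset hx
      have := hinj (a₁ := (j, peelIndex a g k j)) (a₂ := (i, n)) hj
      simp only [Prod.mk.injEq] at this
      obtain ⟨rfl, rfl⟩ := this
      rw [peelIndex_succ_of_mem hx] at hn
      omega

/-- Every ray is peeled infinitely often: the farthest of the remaining points is always removed, so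
that no ray can keep a point while the other rays shrink to `0`. -/
theorem exists_forall_le_peelIndex [Fintype ι] [Nonempty ι] (hpos : ∀ i n, 0 < g i n)
    (hanti : ∀ i, StrictAnti (g i)) (hlim : ∀ i, Tendsto (g i) atTop (𝓝 0))
    (hinj : Function.Injective fun p : ι × ℕ => g p.1 p.2 • a p.1) (ha : ∀ i, a i ≠ 0) (N : ℕ) :
    ∃ k, ∀ i, N ≤ peelIndex a g k i := by
  by_contra! hcon
  obtain ⟨N', hN'⟩ : ∃ N', ∀ n ≥ N', ∀ i j, ‖g j n • a j‖ < ‖g i N • a i‖ := by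
    refine eventually_atTop.1 (eventually_all.2 fun i => eventually_all.2 fun j => ?_)
    have : Tendsto (fun n => ‖g j n • a j‖) atTop (𝓝 0) := by
      simpa using ((hlim j).smul_const (a j)).norm
    exact this.eventually_lt_const (norm_pos_iff.2 (smul_ne_zero (hpos _ _).ne' (ha i)))
  -- while some ray has lost fewer than `N` points, the farthest point lies on a ray that has lost
  -- fewer than `N'` points, so the truncated count of removed points grows in each step
  have hgrow : ∀ k, k ≤ ∑ j, min (peelIndex a g k j) N' := by
    intro k
    induction k with
    | zero => exact Nat.zero_le _
    | succ k ih =>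
      refine Nat.succ_le_of_lt (ih.trans_lt ?_)
      obtain ⟨i, hi⟩ := hcon k
      obtain ⟨j, hj⟩ := Finite.exists_max fun j => ‖g j (peelIndex a g k j) • a j‖
      have hmem := mem_extremePoints_convexHull_range_of_norm_le
        (y := fun j => g j (peelIndex a g k j) • a j)
        (fun j j' h => congrArg Prod.fst (hinj (a₁ := (j, peelIndex a g k j))
          (a₂ := (j', peelIndex a g k j')) h)) hj
      have hlt : peelIndex a g k j < N' := by
        by_contra! h
        have h1 := hN' _ h i j
        have h2 := hj i
        have h3 : ‖g i N • a i‖ < ‖g i (peelIndex a g k i) • a i‖ := by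
          simp only [norm_smul, Real.norm_of_nonneg (hpos _ _).le]
          exact mul_lt_mul_of_pos_right (hanti i hi) (norm_pos_iff.2 (ha i))
        linarith
      refine Finset.sum_lt_sum (fun j _ => min_le_min_right _ (peelIndex_le_succ k j))
        ⟨j, Finset.mem_univ j, ?_⟩
      rw [peelIndex_succ_of_mem hmem]
      omega
  have h1 := hgrow (Fintype.card ι * N' + 1)
  have h2 : ∑ j, min (peelIndex a g (Fintype.card ι * N' + 1) j) N' ≤ Fintype.card ι * N' := by
    simpa using Finset.sum_le_card_nsmul Finset.univ
      (fun j => min (peelIndex a g (Fintype.card ι * N' + 1) j) N') N' fun j _ => min_le_right _ _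
  omega

/-- The peeling index of each ray lags behind the number of steps by a bounded amount only: once all
indices are large, the rays that have been peeled least often are peeled in every step. -/
theorem exists_le_peelIndex_add [Fintype ι] [Nonempty ι] (hpos : ∀ i n, 0 < g i n)
    (hanti : ∀ i, StrictAnti (g i)) (hlim : ∀ i, Tendsto (g i) atTop (𝓝 0))
    (hinj : Function.Injective fun p : ι × ℕ => g p.1 p.2 • a p.1) (ha : ∀ i, a i ≠ 0)
    (hratio : ∀ i j, Tendsto (fun n => g i n / g j n) atTop (𝓝 1)) {q : ℝ} (hq0 : 0 < q)
    (hq1 : q < 1)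
    (hq : ∀ s : ι → ℝ, (∀ i, 0 < s i) → ∀ i, (∀ j, q * s j < s i) →
      s i • a i ∈ (convexHull ℝ (Set.range fun j => s j • a j)).extremePoints ℝ) :
    ∃ K, ∀ k i, k ≤ peelIndex a g k i + K := by
  obtain ⟨N, hN⟩ : ∃ N, ∀ n ≥ N, ∀ i j, q * g j n < g i n := by
    refine eventually_atTop.1 (eventually_all.2 fun i => eventually_all.2 fun j => ?_)
    filter_upwards [(hratio i j).eventually_const_lt hq1] with n hn
    exact (lt_div_iff₀ (hpos _ _)).1 hn
  obtain ⟨K, hK⟩ := exists_forall_le_peelIndex hpos hanti hlim hinj ha N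
  have hkey : ∀ m i, N + m ≤ peelIndex a g (K + m) i := by
    intro m
    induction m with
    | zero => exact hK
    | succ m ih =>
      intro i
      rcases (ih i).eq_or_lt with h | h
      · rw [← add_assoc K, peelIndex_succ_of_mem]
        · omega
        · refine hq (fun j => g j (peelIndex a g (K + m) j)) (fun j => hpos _ _) i fun j => ?_
          have h1 : g j (peelIndex a g (K + m) j) ≤ g j (N + m) := (hanti j).antitone (ih j)
          rw [← h]
          exact (mul_le_mul_of_nonneg_left h1 hq0.le).trans_lt (hN _ (by omega) i j)
      · have := peelIndex_le_succ (a := a) (g := g) (K + m) i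
        rw [← add_assoc K]
        omega
  refine ⟨K, fun k i => ?_⟩
  rcases le_total k K with h | h
  · omega
  · obtain ⟨m, rfl⟩ := Nat.exists_eq_add_of_le h
    have := hkey m i
    omega

/-- If every `a i` is extreme in the convex hull of the `a j`, then it stays extreme when the `a j`
are rescaled by factors that are nearly equal. -/
theorem exists_forall_smul_mem_extremePoints [Fintype ι] [Nonempty ι] {w : ι → ℝ}
    (hw : ∀ i, 0 < w i) (hwa : ∑ i, w i • a i = 0) (hainj : Function.Injective a)
    (ha : ∀ i, a i ≠ 0)
    (hext : ∀ i, a i ∈ (convexHull ℝ (Set.range a)).extremePoints ℝ) :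
    ∃ q : ℝ, 0 < q ∧ q < 1 ∧ ∀ s : ι → ℝ, (∀ i, 0 < s i) → ∀ i, (∀ j, q * s j < s i) →
      s i • a i ∈ (convexHull ℝ (Set.range fun j => s j • a j)).extremePoints ℝ := by
  have h0 : (0 : E) ∈ convexHull ℝ (Set.range a) := by
    simpa using zero_mem_convexHull_range_smul hw hwa (s := fun _ => 1) fun _ => one_pos
  -- separate `a i` from the other points and the origin
  have hsep : ∀ i, ∃ f : StrongDual ℝ E, 0 < f (a i) ∧ ∀ j, j ≠ i → f (a j) < f (a i) := by
    intro i
    set T : Set E := insert 0 (a '' {j | j ≠ i}) with hT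
    have hTfin : T.Finite := ((Set.toFinite _).image _).insert _
    have hnot : a i ∉ convexHull ℝ T := by
      have := (Convex.mem_extremePoints_iff_mem_sdiff_convexHull_sdiff
        (convex_convexHull ℝ (Set.range a))).1 (hext i)
      refine fun h => this.2 (convexHull_mono ?_ h)
      rintro x (rfl | ⟨j, hj, rfl⟩)
      · exact ⟨h0, fun h => ha i (Set.mem_singleton_iff.1 h).symm⟩
      · exact ⟨subset_convexHull ℝ _ ⟨j, rfl⟩, fun h => hj (hainj (Set.mem_singleton_iff.1 h))⟩
    obtain ⟨f, u, h1, h2⟩ := geometric_hahn_banach_closed_point (convex_convexHull ℝ T)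
      (hTfin.isCompact_convexHull (𝕜 := ℝ)).isClosed hnot
    refine ⟨f, ?_, fun j hj => ?_⟩
    · have := h1 0 (subset_convexHull ℝ _ (Set.mem_insert _ _))
      rw [map_zero] at this
      linarith
    · have := h1 (a j) (subset_convexHull ℝ _ (Set.mem_insert_of_mem _ ⟨j, hj, rfl⟩))
      linarith
  choose f hf0 hf using hsep
  have hq : ∀ᶠ q in 𝓝[<] (1 : ℝ), ∀ i j, j ≠ i → f i (a j) < q * f i (a i) := by
    refine eventually_all.2 fun i => eventually_all.2 fun j => ?_
    by_cases hij : j = i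
    · simp [hij]
    · have : Tendsto (fun q : ℝ => q * f i (a i)) (𝓝[<] 1) (𝓝 (1 * f i (a i))) :=
        (tendsto_id.mul_const _).mono_left nhdsWithin_le_nhds
      rw [one_mul] at this
      filter_upwards [this.eventually_const_lt (hf i j hij)] with q hq _ using hq
  obtain ⟨q, ⟨hq, hq0⟩, hq1⟩ := ((hq.and (eventually_nhdsWithin_of_eventually_nhds
    (lt_mem_nhds (zero_lt_one' ℝ)))).and self_mem_nhdsWithin).exists
  refine ⟨q, hq0, hq1, fun s hs i hi => ?_⟩
  refine mem_extremePoints_convexHull_range (y := fun j => s j • a j) (f i).toLinearMap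
    fun j hj => ?_
  simp only [ContinuousLinearMap.coe_coe, map_smul, smul_eq_mul]
  nlinarith [hq i j hj, hf0 i, hi j, hs j]

end Rays

/-! ### Hausdorff distance and normalization of polytopes -/

section Hull

variable {E ι : Type*} [NormedAddCommGroup E] [NormedSpace ℝ E] [Fintype ι]

theorem hausdorffEDist_convexHull_range_le (z w : ι → E) :
    hausdorffEDist (convexHull ℝ (Set.range z)) (convexHull ℝ (Set.range w)) ≤
      ENNReal.ofReal ‖z - w‖ := by
  have key : ∀ z w : ι → E, ∀ x ∈ convexHull ℝ (Set.range z), ∃ y ∈ convexHull ℝ (Set.range w),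
      edist x y ≤ ENNReal.ofReal ‖z - w‖ := by
    intro z w x hx
    have hsub : convexHull ℝ (Set.range z) ⊆
        convexHull ℝ (Set.range w) + closedBall (0 : E) ‖z - w‖ := by
      refine convexHull_min ?_ ((convex_convexHull ℝ _).add (convex_closedBall _ _))
      rintro _ ⟨i, rfl⟩
      exact ⟨w i, subset_convexHull ℝ _ ⟨i, rfl⟩, z i - w i,
        by simpa using norm_le_pi_norm (z - w) i, by simp⟩
    obtain ⟨y, hy, v, hv, rfl⟩ := hsub hx
    refine ⟨y, hy, ?_⟩
    rw [edist_dist, dist_eq_norm, add_sub_cancel_left]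
    exact ENNReal.ofReal_le_ofReal (by simpa using hv)
  refine hausdorffEDist_le_of_mem_edist (key z w) fun x hx => ?_
  obtain ⟨y, hy, h⟩ := key w z x hx
  exact ⟨y, hy, by rwa [norm_sub_rev]⟩

theorem radius_convexHull_range [Nonempty ι] (z : ι → E) :
    radius (convexHull ℝ (Set.range z)) = ‖z‖ := by
  refine IsGreatest.csSup_eq ⟨?_, ?_⟩
  · obtain ⟨i, hi⟩ := Finite.exists_max fun i => ‖z i‖
    refine ⟨z i, subset_convexHull ℝ _ ⟨i, rfl⟩, le_antisymm (norm_le_pi_norm z i) ?_⟩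
    exact (pi_norm_le_iff_of_nonneg (norm_nonneg _)).2 hi
  · rintro _ ⟨x, hx, rfl⟩
    have hsub : convexHull ℝ (Set.range z) ⊆ closedBall (0 : E) ‖z‖ := by
      refine convexHull_min ?_ (convex_closedBall _ _)
      rintro _ ⟨i, rfl⟩
      simpa using norm_le_pi_norm z i
    simpa using hsub hx

omit [Fintype ι] in
theorem smul_convexHull_range (r : ℝ) (z : ι → E) :
    r • convexHull ℝ (Set.range z) = convexHull ℝ (Set.range (r • z)) := by
  rw [← convexHull_smul, ← Set.image_smul, ← Set.range_comp]
  rfl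

theorem normalize_convexHull_range [Nonempty ι] (z : ι → E) :
    normalize (convexHull ℝ (Set.range z)) = convexHull ℝ (Set.range (‖z‖⁻¹ • z)) := by
  rw [normalize, radius_convexHull_range, smul_convexHull_range]

/-- Convergence of the vertices up to scaling implies convergence of the normalized hulls. -/
theorem tendsto_hausdorffEDist_normalize_convexHull [Nonempty ι] {z : ℕ → ι → E} {r : ℕ → ℝ}
    (hr : ∀ᶠ k in atTop, 0 < r k) {w : ι → E} (hw : w ≠ 0)
    (h : Tendsto (fun k => r k • z k) atTop (𝓝 w)) :
    Tendsto (fun k => hausdorffEDist (normalize (convexHull ℝ (Set.range (z k))))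
      (normalize (convexHull ℝ (Set.range w)))) atTop (𝓝 0) := by
  have h1 : Tendsto (fun k => ‖r k • z k‖⁻¹ • r k • z k) atTop (𝓝 (‖w‖⁻¹ • w)) :=
    (h.norm.inv₀ (norm_ne_zero_iff.2 hw)).smul h
  have h2 : Tendsto (fun k => ‖z k‖⁻¹ • z k) atTop (𝓝 (‖w‖⁻¹ • w)) := by
    refine h1.congr' ?_
    filter_upwards [hr] with k hk
    rw [norm_smul, Real.norm_of_nonneg hk.le, mul_inv, smul_smul, mul_right_comm,
      inv_mul_cancel₀ hk.ne', one_mul]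
  have h3 : Tendsto (fun k => ENNReal.ofReal ‖‖z k‖⁻¹ • z k - ‖w‖⁻¹ • w‖) atTop (𝓝 0) := by
    have := (h2.sub_const (‖w‖⁻¹ • w)).norm
    rw [sub_self, norm_zero] at this
    simpa using ENNReal.tendsto_ofReal this
  refine tendsto_of_tendsto_of_tendsto_of_le_of_le tendsto_const_nhds h3
    (fun _ => zero_le) fun k => ?_
  simp only [normalize_convexHull_range]
  exact hausdorffEDist_convexHull_range_le _ _

end Hull

/-! ### Asymptotics of arrival times -/

theorem lilScale_nonneg (x : ℝ) : 0 ≤ lilScale x := Real.sqrt_nonneg _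

theorem lilScale_le_two_mul {x y : ℝ} (hy : Real.exp 1 ≤ y) (hx : 2 ≤ Real.log x)
    (hyx : y ≤ 2 * x) : lilScale y ≤ 2 * lilScale x := by
  have hy0 : 0 < y := (Real.exp_pos 1).trans_le hy
  have hx0 : 0 < x := by linarith
  have hly : 1 ≤ Real.log y := (Real.le_log_iff_exp_le hy0).2 hy
  have hlog : Real.log y ≤ Real.log x ^ 2 := by
    have h1 : Real.log y ≤ Real.log 2 + Real.log x := by
      rw [← Real.log_mul (by norm_num) hx0.ne']
      exact Real.log_le_log hy0 hyx
    have := Real.log_two_lt_d9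
    nlinarith
  have hll : Real.log (Real.log y) ≤ 2 * Real.log (Real.log x) := by
    refine (Real.log_le_log (by linarith) hlog).trans_eq ?_
    rw [Real.log_pow]; norm_num
  have h0 : 0 ≤ Real.log (Real.log y) := Real.log_nonneg hly
  have : lilScale y ≤ √(2 ^ 2 * (x * Real.log (Real.log x))) := by
    refine Real.sqrt_le_sqrt ?_
    calc y * Real.log (Real.log y) ≤ (2 * x) * (2 * Real.log (Real.log x)) :=
          mul_le_mul hyx hll h0 (by linarith)
      _ = _ := by ring
  rwa [Real.sqrt_mul (by norm_num : (0 : ℝ) ≤ 2 ^ 2), Real.sqrt_sq (by norm_num)] at this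

theorem lilScale_comp_isBigO {u v : ℕ → ℕ} (hu : Tendsto u atTop atTop)
    (huv : ∀ᶠ n in atTop, u n ≤ 2 * v n) :
    (fun n => lilScale (u n)) =O[atTop] fun n => lilScale (v n) := by
  have hv : Tendsto v atTop atTop := by
    refine tendsto_atTop.2 fun b => ?_
    filter_upwards [huv, hu.eventually_ge_atTop (2 * b)] with n h1 h2
    omega
  have hu' : Tendsto (fun n => (u n : ℝ)) atTop atTop := tendsto_natCast_atTop_atTop.comp hu
  have hv' : Tendsto (fun n => Real.log (v n)) atTop atTop :=
    Real.tendsto_log_atTop.comp (tendsto_natCast_atTop_atTop.comp hv)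
  refine IsBigO.of_bound 2 ?_
  filter_upwards [huv, hu'.eventually_ge_atTop (Real.exp 1), hv'.eventually_ge_atTop 2]
    with n h1 h2 h3
  rw [Real.norm_of_nonneg (lilScale_nonneg _), Real.norm_of_nonneg (lilScale_nonneg _)]
  exact lilScale_le_two_mul h2 h3 (by exact_mod_cast h1)

theorem const_isBigO_lilScale (c : ℝ) :
    (fun _ : ℕ => c) =O[atTop] fun n : ℕ => lilScale n := by
  have h : Tendsto (fun n : ℕ => Real.log (Real.log n)) atTop atTop :=
    Real.tendsto_log_atTop.comp (Real.tendsto_log_atTop.comp tendsto_natCast_atTop_atTop)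
  refine (isBigO_const_const c (one_ne_zero (α := ℝ)) atTop).trans (IsBigO.of_bound 1 ?_)
  filter_upwards [h.eventually_ge_atTop 1, eventually_ge_atTop 1] with n h1 h2
  rw [norm_one, one_mul, Real.norm_of_nonneg (lilScale_nonneg _), lilScale, Real.one_le_sqrt]
  have : (1 : ℝ) ≤ n := by exact_mod_cast h2
  nlinarith

theorem lilScale_div_eq (n : ℕ) : lilScale n / n = √(Real.log (Real.log n) / n) := by
  rcases Nat.eq_zero_or_pos n with rfl | hn
  · simp
  · have hn' : (0 : ℝ) < n := by exact_mod_cast hn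
    rw [lilScale, div_eq_iff hn'.ne', ← Real.sqrt_sq hn'.le, ← Real.sqrt_mul' _ (sq_nonneg _),
      Real.sqrt_sq hn'.le]
    congr 1
    field_simp

theorem tendsto_log_log_div : Tendsto (fun n : ℕ => Real.log (Real.log n) / n) atTop (𝓝 0) := by
  have h1 : (fun n : ℕ => Real.log (Real.log n)) =o[atTop] fun n : ℕ => Real.log n :=
    Real.isLittleO_log_id_atTop.comp_tendsto
      (Real.tendsto_log_atTop.comp tendsto_natCast_atTop_atTop)
  have h2 : (fun n : ℕ => Real.log n) =o[atTop] fun n : ℕ => (n : ℝ) :=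
    Real.isLittleO_log_id_atTop.comp_tendsto tendsto_natCast_atTop_atTop
  exact (h1.trans h2).tendsto_div_nhds_zero

theorem lilScale_isLittleO : (fun n : ℕ => lilScale n) =o[atTop] fun n : ℕ => (n : ℝ) := by
  refine (isLittleO_iff_tendsto' ?_).2 ?_
  · filter_upwards [eventually_gt_atTop 0] with n hn h
    exact absurd h (Nat.cast_pos.2 hn).ne'
  · simp only [lilScale_div_eq]
    simpa using tendsto_log_log_div.sqrt

/-- An infinite set of reals with only finitely many elements below any bound can be listed
increasingly. -/
theorem exists_strictMono_range_eq {T : Set ℝ} (hfin : ∀ n : ℕ, (T ∩ Set.Iic (n : ℝ)).Finite)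
    (hinf : T.Infinite) : ∃ Γ : ℕ → ℝ, StrictMono Γ ∧ Set.range Γ = T := by
  have hfin' : ∀ x : ℝ, (T ∩ Set.Iic x).Finite := fun x => by
    obtain ⟨n, hn⟩ := exists_nat_ge x
    exact (hfin n).subset (Set.inter_subset_inter_right _ (Set.Iic_subset_Iic.2 hn))
  have hIic : ∀ x : T, (Set.Iic x).Finite := fun x => by
    refine Set.Finite.of_finite_image (f := Subtype.val) ((hfin' x).subset ?_)
      Subtype.val_injective.injOn
    rintro _ ⟨y, hy, rfl⟩
    exact ⟨y.2, hy⟩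
  have : Infinite T := hinf.to_subtype
  let : LocallyFiniteOrder T := LocallyFiniteOrder.ofFiniteIcc fun a b =>
    (hIic b).subset Set.Icc_subset_Iic_self
  obtain ⟨b, hb⟩ : ∃ b : T, ∀ x, b ≤ x := by
    obtain ⟨x⟩ : Nonempty T := inferInstance
    obtain ⟨b, hb, hmin⟩ := (hIic x).exists_minimal ⟨x, Set.mem_Iic.2 le_rfl⟩
    refine ⟨b, fun y => ?_⟩
    by_contra! hy
    exact hy.not_ge (hmin (hy.le.trans hb) hy.le)
  let : OrderBot T := { bot := b, bot_le := hb }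
  have : NoMaxOrder T := ⟨fun x => by
    by_contra! h
    exact Set.infinite_univ ((hIic x).subset fun y _ => h y)⟩
  let := LinearLocallyFiniteOrder.succOrder T
  let := LinearLocallyFiniteOrder.predOrder T
  let φ : T ≃o ℕ := orderIsoNatOfLinearSuccPredArch
  refine ⟨fun n => (φ.symm n : ℝ), fun m n h => φ.symm.strictMono h, ?_⟩
  ext x
  constructor
  · rintro ⟨n, rfl⟩
    exact (φ.symm n).2
  · exact fun hx => ⟨φ ⟨x, hx⟩, by simp⟩

/-- If the counting function of a set of positive reals satisfies the law of the iterated logarithm,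
then so do the points of the set, listed increasingly. -/
theorem exists_strictMono_range_eq_of_count {T : Set ℝ} (hpos : ∀ t ∈ T, 0 < t)
    (hfin : ∀ n : ℕ, (T ∩ Set.Iic (n : ℝ)).Finite)
    (hcount : (fun n : ℕ => ((T ∩ Set.Iic (n : ℝ)).ncard : ℝ) - n)
      =O[atTop] fun n : ℕ => lilScale n) :
    ∃ Γ : ℕ → ℝ, StrictMono Γ ∧ Set.range Γ = T ∧
      (fun n : ℕ => Γ n - n) =O[atTop] fun n : ℕ => lilScale n := by
  set N : ℕ → ℕ := fun n => (T ∩ Set.Iic (n : ℝ)).ncard with hN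
  change (fun n : ℕ => (N n : ℝ) - n) =O[atTop] _ at hcount
  have hinf : T.Infinite := by
    intro hT
    have h1 : (fun n : ℕ => ((N n : ℝ)) - n) =o[atTop] fun n : ℕ => (n : ℝ) :=
      hcount.trans_isLittleO lilScale_isLittleO
    obtain ⟨n, hn, hn'⟩ := ((h1.bound (show (0 : ℝ) < 1 / 2 by norm_num)).and
      (eventually_gt_atTop (2 * T.ncard))).exists
    have h2 : (N n : ℝ) ≤ T.ncard := by
      exact_mod_cast Set.ncard_le_ncard Set.inter_subset_left hT
    have h3 : (2 * T.ncard : ℝ) < n := by exact_mod_cast hn'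
    rw [Real.norm_eq_abs, Real.norm_of_nonneg (Nat.cast_nonneg n)] at hn
    have := (abs_le.1 hn).1
    linarith
  obtain ⟨Γ, hmono, hrange⟩ := exists_strictMono_range_eq hfin hinf
  refine ⟨Γ, hmono, hrange, ?_⟩
  have hΓpos : ∀ n, 0 < Γ n := fun n => hpos _ (hrange ▸ ⟨n, rfl⟩)
  have hcard : ∀ n, (T ∩ Set.Iic (Γ n)).ncard = n + 1 := by
    intro n
    have : T ∩ Set.Iic (Γ n) = Γ '' Set.Iic n := by
      rw [← hrange]
      ext x
      constructor
      · rintro ⟨⟨m, rfl⟩, hm⟩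
        exact ⟨m, hmono.le_iff_le.1 hm, rfl⟩
      · rintro ⟨m, hm, rfl⟩
        exact ⟨⟨m, rfl⟩, hmono.monotone hm⟩
    rw [this, Set.ncard_image_of_injective _ hmono.injective, ← Finset.coe_Iic,
      Set.ncard_coe_finset, Nat.card_Iic]
  have hle : ∀ n M : ℕ, Γ n ≤ M → n + 1 ≤ N M := fun n M h => by
    rw [← hcard n]
    exact Set.ncard_le_ncard (Set.inter_subset_inter_right _ (Set.Iic_subset_Iic.2 h)) (hfin M)
  have hge : ∀ n M : ℕ, (M : ℝ) ≤ Γ n → N M ≤ n + 1 := fun n M h => by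
    rw [← hcard n]
    refine Set.ncard_le_ncard (Set.inter_subset_inter_right _ (Set.Iic_subset_Iic.2 h)) ?_
    exact Set.finite_of_ncard_ne_zero (by rw [hcard]; omega)
  have hΓlim : Tendsto Γ atTop atTop := by
    refine tendsto_atTop.2 fun b => ?_
    obtain ⟨M, hM⟩ := exists_nat_ge b
    filter_upwards [eventually_ge_atTop (N M)] with n hn
    by_contra! h
    have := hle n M (h.le.trans hM)
    omega
  -- compare `n` with the counts at the integers next to `Γ n`
  set m : ℕ → ℕ := fun n => ⌊Γ n⌋₊ with hm
  have hmlim : Tendsto m atTop atTop := tendsto_nat_floor_atTop.comp hΓlim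
  have hm1 : ∀ n, (m n : ℝ) ≤ Γ n := fun n => Nat.floor_le (hΓpos n).le
  have hm2 : ∀ n, Γ n ≤ (m n + 1 : ℕ) := fun n => by
    push_cast; exact (Nat.lt_floor_add_one _).le
  have hmO : (fun n => Γ n - n) =O[atTop] fun n => lilScale (m n) := by
    have h1 := hcount.comp_tendsto hmlim
    have h2 := hcount.comp_tendsto ((tendsto_add_atTop_nat 1).comp hmlim)
    have h3 : (fun n => lilScale ((m n + 1 : ℕ))) =O[atTop] fun n => lilScale (m n) := by
      refine lilScale_comp_isBigO ((tendsto_add_atTop_nat 1).comp hmlim) ?_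
      filter_upwards [hmlim.eventually_ge_atTop 1] with n hn
      omega
    have h4 := (const_isBigO_lilScale 2).comp_tendsto hmlim
    refine IsBigO.trans (IsBigO.of_bound 1 (Eventually.of_forall fun n => ?_))
      ((h1.norm_left.add (h2.trans h3).norm_left).add h4)
    simp only [Function.comp_apply, Real.norm_eq_abs, one_mul]
    refine le_trans ?_ (le_abs_self _)
    have h5 : (N (m n) : ℝ) ≤ n + 1 := by exact_mod_cast hge n (m n) (hm1 n)
    have h6 : (n : ℝ) + 1 ≤ N (m n + 1) := by exact_mod_cast hle n (m n + 1) (hm2 n)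
    have h7 := neg_abs_le ((N (m n) : ℝ) - m n)
    have h8 := le_abs_self ((N (m n + 1) : ℝ) - (m n + 1 : ℕ))
    have h9 := abs_nonneg ((N (m n) : ℝ) - m n)
    have h10 := abs_nonneg ((N (m n + 1) : ℝ) - (m n + 1 : ℕ))
    have h11 := hm1 n
    have h12 := hm2 n
    push_cast at h8 h10 h12 ⊢
    rw [abs_le]
    constructor <;> linarith
  -- replace the scale at `⌊Γ n⌋` by the scale at `n`
  refine hmO.trans (lilScale_comp_isBigO hmlim ?_)
  have h1 := hmO.trans_isLittleO (lilScale_isLittleO.comp_tendsto hmlim)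
  filter_upwards [h1.bound (show (0 : ℝ) < 1 / 2 by norm_num)] with n hn
  simp only [Function.comp_apply, Real.norm_eq_abs, Nat.abs_cast] at hn
  have := (abs_le.1 hn).2
  have h2 := hm1 n
  have : (m n : ℝ) ≤ 2 * n := by linarith
  exact_mod_cast this

/-- The rescaled positions `k ^ β * Γ (c k) ^ (-β)` tend to `1` at the rate of the law of
the iterated logarithm if `c k` stays within bounded distance of `k`. -/
theorem rpow_mul_rpow_sub_one_isBigO {Γ : ℕ → ℝ} (hΓ : ∀ n, 0 < Γ n)
    (hO : (fun n : ℕ => Γ n - n) =O[atTop] fun n : ℕ => lilScale n) {c : ℕ → ℕ} {K : ℕ}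
    (hc : ∀ k, c k ≤ k) (hcK : ∀ k, k ≤ c k + K) (β : ℝ) :
    (fun k : ℕ => (k : ℝ) ^ β * Γ (c k) ^ (-β) - 1)
      =O[atTop] fun k : ℕ => √(Real.log (Real.log k) / k) := by
  have hclim : Tendsto c atTop atTop := by
    refine tendsto_atTop.2 fun b => ?_
    filter_upwards [eventually_ge_atTop (b + K)] with k hk
    have := hcK k
    omega
  have h1 : (fun k : ℕ => Γ (c k) - k) =O[atTop] fun k : ℕ => lilScale k := by
    have h2 := (hO.comp_tendsto hclim).trans
      (lilScale_comp_isBigO hclim (v := id) (.of_forall fun k => by have := hc k; simp; omega))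
    have h3 : (fun k : ℕ => (c k : ℝ) - k) =O[atTop] fun k : ℕ => lilScale k := by
      refine IsBigO.trans (IsBigO.of_bound 1 (.of_forall fun k => ?_)) (const_isBigO_lilScale K)
      have h4 : (c k : ℝ) ≤ k := by exact_mod_cast hc k
      have h5 : (k : ℝ) ≤ c k + K := by exact_mod_cast hcK k
      rw [one_mul, Real.norm_eq_abs, Real.norm_of_nonneg (Nat.cast_nonneg _), abs_le]
      constructor <;> linarith [(Nat.cast_nonneg K : (0 : ℝ) ≤ K)]
    refine (h2.add h3).congr_left fun k => ?_
    simp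
  have h2 : (fun k : ℕ => Γ (c k) / k - 1)
      =O[atTop] fun k : ℕ => √(Real.log (Real.log k) / k) := by
    refine (h1.mul (isBigO_refl (fun k : ℕ => (k : ℝ)⁻¹) atTop)).congr' ?_ ?_
    · filter_upwards [eventually_gt_atTop 0] with k hk
      have : (k : ℝ) ≠ 0 := by exact_mod_cast hk.ne'
      field_simp
    · exact .of_forall fun k => (div_eq_mul_inv _ _).symm.trans (lilScale_div_eq k)
  have hlim : Tendsto (fun k : ℕ => Γ (c k) / k) atTop (𝓝 1) := by
    have h3 : Tendsto (fun k : ℕ => √(Real.log (Real.log k) / k)) atTop (𝓝 0) := by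
      simpa using tendsto_log_log_div.sqrt
    simpa using (h2.trans_tendsto h3).add_const 1
  have hder : HasDerivAt (fun x : ℝ => x ^ (-β)) (-β * 1 ^ (-β - 1)) 1 :=
    Real.hasDerivAt_rpow_const (Or.inl one_ne_zero)
  refine ((hder.isBigO_sub.comp_tendsto hlim).trans h2).congr' ?_ EventuallyEq.rfl
  filter_upwards [eventually_gt_atTop 0] with k hk
  have hk' : (0 : ℝ) < k := by exact_mod_cast hk
  simp only [Function.comp_apply, Real.one_rpow]
  rw [Real.div_rpow (hΓ _).le hk'.le, Real.rpow_neg hk'.le, div_inv_eq_mul, mul_comm]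

/-! ### Limit of the peels for points at asymptotically regular positions -/

section Deterministic

variable {E ι : Type*} [NormedAddCommGroup E] [InnerProductSpace ℝ E] [Fintype ι] [Nonempty ι]

/-- If the points on the ray of `a i` are `Γ i n ^ (-β) • a i`, where `Γ i n` is close to `n`, then
the `k`-th peel is the convex hull of one point from each ray, and these points, rescaled by
`k ^ β`, are close to the `a i`. -/
theorem exists_peel_eq_convexHull_range {a : ι → E} {w : ι → ℝ} (hw : ∀ i, 0 < w i)
    (hwa : ∑ i, w i • a i = 0) (ha : ∀ i, a i ≠ 0)
    (hray : ∀ i j : ι, ∀ s t : ℝ, 0 < s → 0 < t → s • a i = t • a j → i = j)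
    (hext : ∀ i, a i ∈ (convexHull ℝ (Set.range a)).extremePoints ℝ)
    {β : ℝ} (hβ : 0 < β) {Γ : ι → ℕ → ℝ} (hmono : ∀ i, StrictMono (Γ i))
    (hpos : ∀ i n, 0 < Γ i n)
    (hO : ∀ i, (fun n : ℕ => Γ i n - n) =O[atTop] fun n : ℕ => lilScale n) :
    ∃ z : ℕ → ι → E,
      (∀ k, peel (Set.range fun p : ι × ℕ => Γ p.1 p.2 ^ (-β) • a p.1) k =
        convexHull ℝ (Set.range (z k))) ∧
      (fun k : ℕ => (k : ℝ) ^ β • z k - a)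
        =O[atTop] fun k : ℕ => √(Real.log (Real.log k) / k) := by
  set g : ι → ℕ → ℝ := fun i n => Γ i n ^ (-β) with hg
  have hgpos : ∀ i n, 0 < g i n := fun i n => Real.rpow_pos_of_pos (hpos i n) _
  have hganti : ∀ i, StrictAnti (g i) := fun i m n h =>
    Real.rpow_lt_rpow_of_neg (hpos i m) (hmono i h) (by linarith)
  have hsqrt : Tendsto (fun k : ℕ => √(Real.log (Real.log k) / k)) atTop (𝓝 0) := by
    simpa using tendsto_log_log_div.sqrt
  have hone : ∀ i, Tendsto (fun n : ℕ => (n : ℝ) ^ β * g i n) atTop (𝓝 1) := fun i => by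
    have := rpow_mul_rpow_sub_one_isBigO (hpos i) (hO i) (c := id) (K := 0) (fun k => le_rfl)
      (fun k => le_rfl) β
    simpa using (this.trans_tendsto hsqrt).add_const 1
  have hratio : ∀ i j, Tendsto (fun n => g i n / g j n) atTop (𝓝 1) := fun i j => by
    have := (hone i).div (hone j) one_ne_zero
    rw [div_one] at this
    refine this.congr' ?_
    filter_upwards [eventually_gt_atTop 0] with n hn
    exact mul_div_mul_left _ _ (Real.rpow_pos_of_pos (by exact_mod_cast hn) _).ne'
  have hlim : ∀ i, Tendsto (g i) atTop (𝓝 0) := fun i => by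
    have := (hone i).mul ((tendsto_rpow_neg_atTop hβ).comp tendsto_natCast_atTop_atTop)
    rw [one_mul] at this
    refine this.congr' ?_
    filter_upwards [eventually_gt_atTop 0] with n hn
    have hn' : (0 : ℝ) < n := by exact_mod_cast hn
    simp only [Function.comp_apply, Real.rpow_neg hn'.le]
    have := (Real.rpow_pos_of_pos hn' β).ne'
    field_simp
  have hinj : Function.Injective fun p : ι × ℕ => g p.1 p.2 • a p.1 := by
    rintro ⟨i, m⟩ ⟨j, n⟩ h
    simp only at h
    obtain rfl := hray i j _ _ (hgpos i m) (hgpos j n) h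
    rw [(hganti i).injective (smul_left_injective ℝ (ha i) h)]
  have hainj : Function.Injective a := fun i j h =>
    hray i j 1 1 one_pos one_pos (by rw [h])
  obtain ⟨q, hq0, hq1, hq⟩ := exists_forall_smul_mem_extremePoints hw hwa hainj ha hext
  obtain ⟨K, hK⟩ := exists_le_peelIndex_add hgpos hganti hlim hinj ha hratio hq0 hq1 hq
  refine ⟨fun k i => g i (peelIndex a g (k - 1) i) • a i, fun k => ?_, ?_⟩
  · rw [peel, remaining_range_eq_rayTail hw hwa hgpos hganti hinj,
      convexHull_rayTail hw hwa hgpos hganti]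
  · refine isBigO_pi.2 fun i => ?_
    have := rpow_mul_rpow_sub_one_isBigO (hpos i) (hO i) (c := fun k => peelIndex a g (k - 1) i)
      -- the `k`-th peel is the hull of what is left after `k - 1` steps
      (K := K + 1) (fun k => (peelIndex_le (k - 1) i).trans (Nat.sub_le k 1))
      (fun k => by have := hK (k - 1) i; omega) β
    have h1 := this.smul (isBigO_refl (fun _ : ℕ => a i) atTop)
    refine (h1.congr_left fun k => ?_).trans (IsBigO.of_bound ‖a i‖ (.of_forall fun k => ?_))
    · simp only [Pi.sub_apply, Pi.smul_apply, smul_smul, sub_smul, one_smul, hg]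
    · rw [norm_smul, mul_comm]

/-- Both claims on the peels, for a fixed configuration of points. -/
theorem peel_isBigO_and_tendsto_normalize {a : ι → E} {w : ι → ℝ} (hw : ∀ i, 0 < w i)
    (hwa : ∑ i, w i • a i = 0) (ha : ∀ i, a i ≠ 0)
    (hray : ∀ i j : ι, ∀ s t : ℝ, 0 < s → 0 < t → s • a i = t • a j → i = j)
    (hext : ∀ i, a i ∈ (convexHull ℝ (Set.range a)).extremePoints ℝ)
    {β : ℝ} (hβ : 0 < β) {Γ : ι → ℕ → ℝ} (hmono : ∀ i, StrictMono (Γ i))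
    (hpos : ∀ i n, 0 < Γ i n)
    (hO : ∀ i, (fun n : ℕ => Γ i n - n) =O[atTop] fun n : ℕ => lilScale n) {S : Set E}
    (hS : S = Set.range fun p : ι × ℕ => Γ p.1 p.2 ^ (-β) • a p.1) :
    ((∀ᶠ k : ℕ in atTop,
        hausdorffEDist ((k : ℝ) ^ β • peel S k) (convexHull ℝ (Set.range a)) ≠ ∞) ∧
      (fun k : ℕ => hausdorffDist ((k : ℝ) ^ β • peel S k) (convexHull ℝ (Set.range a)))
        =O[atTop] fun k : ℕ => √(Real.log (Real.log k) / k)) ∧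
    Tendsto (fun k => hausdorffEDist (normalize (peel S k))
      (normalize (convexHull ℝ (Set.range a)))) atTop (𝓝 0) := by
  obtain ⟨z, hz, hza⟩ := exists_peel_eq_convexHull_range hw hwa ha hray hext hβ hmono hpos hO
  have hle : ∀ k : ℕ, hausdorffEDist ((k : ℝ) ^ β • peel S k) (convexHull ℝ (Set.range a)) ≤
      ENNReal.ofReal ‖(k : ℝ) ^ β • z k - a‖ := fun k => by
    rw [hS, hz, smul_convexHull_range]
    exact hausdorffEDist_convexHull_range_le _ _
  refine ⟨⟨.of_forall fun k => ne_top_of_le_ne_top ENNReal.ofReal_ne_top (hle k), ?_⟩, ?_⟩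
  · refine IsBigO.trans (IsBigO.of_bound 1 (.of_forall fun k => ?_)) hza
    rw [one_mul, Real.norm_of_nonneg hausdorffDist_nonneg]
    exact ENNReal.toReal_le_of_le_ofReal (norm_nonneg _) (hle k)
  · simp only [hS, hz]
    refine tendsto_hausdorffEDist_normalize_convexHull (r := fun k : ℕ => (k : ℝ) ^ β) ?_ ?_ ?_
    · filter_upwards [eventually_gt_atTop 0] with k hk
      exact Real.rpow_pos_of_pos (by exact_mod_cast hk) _
    · obtain ⟨i⟩ := ‹Nonempty ι›
      exact fun h => ha i (congrFun h i)
    · have h0 : Tendsto (fun k : ℕ => √(Real.log (Real.log k) / k)) atTop (𝓝 0) := by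
        simpa using tendsto_log_log_div.sqrt
      simpa using (hza.trans_tendsto h0).add_const a

end Deterministic

/-! ### Counting the points of a Poisson process in an increasing sequence of sets -/

section PoissonProcess

variable {E Ω : Type*} [MeasurableSpace E] [MeasurableSpace Ω] {μ : Measure E} {π : Ω → Set E}
  {P : Measure Ω}

theorem IsPoissonPointProcess.ae_encard_ne_top [IsProbabilityMeasure P]
    (hπ : IsPoissonPointProcess μ π P) {B : Set E} (hB : MeasurableSet B) (hμ : μ B ≠ ∞) :
    ∀ᵐ ω ∂P, (π ω ∩ B).encard ≠ ⊤ := by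
  have hmeas : ∀ n : ℕ, MeasurableSet {ω | (π ω ∩ B).encard = n} := fun n =>
    hπ.measurable_count B hB (measurableSet_singleton (n : ℕ∞))
  have h1 : P (⋃ n : ℕ, {ω | (π ω ∩ B).encard = n}) = 1 := by
    rw [measure_iUnion ?_ hmeas]
    · simp only [hπ.poisson_count B hB hμ]
      rw [← measure_iUnion (fun m n h => Set.disjoint_singleton.2 h)
        fun n => measurableSet_singleton n, Set.iUnion_of_singleton, measure_univ]
    · refine fun m n hmn => Set.disjoint_left.2 fun ω h h' => hmn ?_
      exact_mod_cast (h.symm.trans h' : (m : ℕ∞) = n)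
  have h2 : ∀ᵐ ω ∂P, ω ∈ ⋃ n : ℕ, {ω | (π ω ∩ B).encard = n} :=
    (mem_ae_iff_prob_eq_one₀ (MeasurableSet.iUnion hmeas).nullMeasurableSet).2 h1
  filter_upwards [h2] with ω hω
  obtain ⟨n, hn⟩ := Set.mem_iUnion.1 hω
  rw [show (π ω ∩ B).encard = n from hn]
  exact ENat.natCast_ne_top n

theorem IsPoissonPointProcess.map_toNat_encard [IsProbabilityMeasure P]
    (hπ : IsPoissonPointProcess μ π P) {B : Set E} (hB : MeasurableSet B) (hμ : μ B ≠ ∞) :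
    P.map (fun ω => (π ω ∩ B).encard.toNat) = poissonMeasure (μ B).toNNReal := by
  have hm : Measurable fun ω => (π ω ∩ B).encard.toNat :=
    (Measurable.of_discrete (f := ENat.toNat)).comp (hπ.measurable_count B hB)
  refine Measure.ext_of_singleton fun n => ?_
  rw [Measure.map_apply hm (measurableSet_singleton n), ← hπ.poisson_count B hB hμ n]
  refine measure_congr ?_
  filter_upwards [hπ.ae_encard_ne_top hB hμ] with ω hω
  refine propext ⟨fun h => ?_, fun h => ?_⟩
  · have h : (π ω ∩ B).encard.toNat = n := h
    change (π ω ∩ B).encard = n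
    rw [← h, ENat.natCast_toNat hω]
  · have h : (π ω ∩ B).encard = n := h
    change (π ω ∩ B).encard.toNat = n
    rw [h, ENat.toNat_natCast]

theorem IsPoissonPointProcess.ae_subset (hπ : IsPoissonPointProcess μ π P)
    [IsProbabilityMeasure P] {B : Set E} (hB : MeasurableSet B) (hμ : μ Bᶜ = 0) :
    ∀ᵐ ω ∂P, π ω ⊆ B := by
  have h := hπ.poisson_count Bᶜ hB.compl (by simp [hμ]) 0
  have h1 : poissonMeasure (μ Bᶜ).toNNReal {0} = 1 := by
    rw [hμ, poissonMeasure_singleton]; simp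
  have hmeas : MeasurableSet {ω | (π ω ∩ Bᶜ).encard = (0 : ℕ)} :=
    hπ.measurable_count _ hB.compl (measurableSet_singleton ((0 : ℕ) : ℕ∞))
  rw [h1] at h
  filter_upwards [(mem_ae_iff_prob_eq_one₀ hmeas.nullMeasurableSet).2 h] with ω hω
  have hω : (π ω ∩ Bᶜ).encard = (0 : ℕ) := hω
  rw [Nat.cast_zero, Set.encard_eq_zero] at hω
  intro x hx
  by_contra hxB
  exact Set.notMem_empty x (hω ▸ ⟨hx, hxB⟩)

theorem IsPoissonPointProcess.iIndepFun_count (hπ : IsPoissonPointProcess μ π P) {D : ℕ → Set E}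
    (hD : ∀ n, MeasurableSet (D n)) (hdisj : Pairwise (Function.onFun Disjoint D)) :
    iIndepFun (fun n ω => (π ω ∩ D n).encard) P := by
  refine iIndepFun_iff_finset.2 fun s => ?_
  obtain ⟨N, hN⟩ := s.exists_nat_subset_range
  have h := hπ.independent_count N (fun i => D i) (fun i => hD i)
    fun i j hij => hdisj fun h => hij (Fin.ext h)
  exact h.precomp (g := fun n : s => (⟨n, Finset.mem_range.1 (hN n.2)⟩ : Fin N))
    fun m n hmn => Subtype.ext (congrArg Fin.val hmn)

/-- The counts of the points in sets of measure `0, 1, 2, …` satisfy the law of the iterated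
logarithm, because their increments are independent Poisson variables of mean `1`. -/
theorem IsPoissonPointProcess.ae_ncard_sub_isBigO [IsProbabilityMeasure P]
    (hπ : IsPoissonPointProcess μ π P) {B : ℕ → Set E} (hB : ∀ n, MeasurableSet (B n))
    (hmono : Monotone B) (hμ : ∀ n : ℕ, μ (B n) = n) (h0 : B 0 = ∅) :
    ∀ᵐ ω ∂P, (∀ n, (π ω ∩ B n).Finite) ∧ (fun n : ℕ => ((π ω ∩ B n).ncard : ℝ) - n)
      =O[atTop] fun n : ℕ => lilScale n := by
  set D : ℕ → Set E := fun n => B (n + 1) \ B n with hDdef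
  have hD : ∀ n, MeasurableSet (D n) := fun n => (hB _).diff (hB _)
  have hμD : ∀ n, μ (D n) = 1 := fun n => by
    rw [hDdef, measure_sdiff (hmono n.le_succ) (hB n).nullMeasurableSet (by simp [hμ]), hμ, hμ,
      Nat.cast_succ]
    exact ENNReal.add_sub_cancel_left (ENNReal.natCast_ne_top n)
  have hdisj : Pairwise (Function.onFun Disjoint D) := by
    rw [pairwise_disjoint_on]
    exact fun m n hmn => Set.disjoint_left.2 fun x hx hx' => hx'.2 (hmono hmn hx.1)
  set Y : ℕ → Ω → ℕ := fun n ω => (π ω ∩ D n).encard.toNat with hY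
  have hYm : ∀ n, Measurable (Y n) := fun n =>
    (Measurable.of_discrete (f := ENat.toNat)).comp (hπ.measurable_count _ (hD n))
  have hind : iIndepFun Y P :=
    (hπ.iIndepFun_count hD hdisj).comp (fun _ => ENat.toNat) fun _ => .of_discrete
  have hlaw : ∀ n, P.map (Y n) = poissonMeasure 1 := fun n => by
    rw [hπ.map_toNat_encard (hD n) (by simp [hμD]), hμD]
    simp
  filter_upwards [ae_poisson_sum_isBigO hind hYm hlaw,
    ae_all_iff.2 fun n => hπ.ae_encard_ne_top (hB n) (by simp [hμ])] with ω hω hfin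
  have hfin' : ∀ n, (π ω ∩ B n).Finite := fun n => Set.encard_ne_top_iff.1 (hfin n)
  refine ⟨hfin', hω.congr_left fun n => ?_⟩
  congr 1
  induction n with
  | zero => simp [h0]
  | succ n ih =>
    rw [Finset.sum_range_succ, ih]
    have hsplit : π ω ∩ B (n + 1) = (π ω ∩ B n) ∪ (π ω ∩ D n) := by
      rw [← Set.inter_union_distrib_left, hDdef, Set.union_sdiff_cancel (hmono n.le_succ)]
    have hd : Disjoint (π ω ∩ B n) (π ω ∩ D n) :=
      Set.disjoint_left.2 fun x hx hx' => hx'.2.2 hx.2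
    rw [hsplit, Set.ncard_union_eq hd (hfin' n) ((hfin' (n + 1)).subset
      (Set.inter_subset_inter_right _ Set.sdiff_subset)), Nat.cast_add]
    rfl

end PoissonProcess

/-! ### The intensity measure on the rays -/

section Intensity

theorem radialMeasure_setOf_le {α : ℝ} (hα : 0 < α) {v t : ℝ} (hv : 0 < v) (ht : 0 < t) :
    radialMeasure α {r | 0 < r ∧ v * r ^ (-α) ≤ t} = ENNReal.ofReal (t / v) := by
  have hvt : 0 < v / t := div_pos hv ht
  set ρ : ℝ := (v / t) ^ (1 / α) with hρ
  have hρ0 : 0 < ρ := Real.rpow_pos_of_pos hvt _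
  have hρα : ρ ^ α = v / t := by
    rw [hρ, ← Real.rpow_mul hvt.le, one_div_mul_cancel hα.ne', Real.rpow_one]
  have hset : {r | 0 < r ∧ v * r ^ (-α) ≤ t} = Set.Ici ρ := by
    ext r
    simp only [Set.mem_ofPred_eq, Set.mem_Ici]
    have key : ∀ r : ℝ, 0 < r → (v * r ^ (-α) ≤ t ↔ ρ ≤ r) := fun r hr => by
      rw [← Real.rpow_le_rpow_iff hρ0.le hr.le hα, hρα, Real.rpow_neg hr.le, ← div_eq_mul_inv,
        div_le_iff₀ (Real.rpow_pos_of_pos hr α), div_le_iff₀' ht]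
    exact ⟨fun h => (key r h.1).1 h.2, fun h => ⟨hρ0.trans_le h, (key r (hρ0.trans_le h)).2 h⟩⟩
  have hexp : -α - 1 < -1 := by linarith
  have hint : IntegrableOn (fun r : ℝ => α * r ^ (-α - 1)) (Set.Ioi ρ) :=
    (integrableOn_Ioi_rpow_of_lt hexp hρ0).const_mul α
  rw [hset, radialMeasure, withDensity_apply _ measurableSet_Ici,
    Measure.restrict_restrict measurableSet_Ici,
    Set.inter_eq_left.2 (Set.Ici_subset_Ioi.2 hρ0),
    setLIntegral_congr Ioi_ae_eq_Ici.symm, ← ofReal_integral_eq_lintegral_ofReal hint]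
  · rw [integral_const_mul, integral_Ioi_rpow_of_lt hexp hρ0, sub_add_cancel,
      Real.rpow_neg hρ0.le, hρα]
    congr 1
    field_simp
  · filter_upwards [ae_restrict_mem measurableSet_Ioi] with r hr
    exact mul_nonneg hα.le (Real.rpow_nonneg (hρ0.trans (Set.mem_Ioi.1 hr)).le _)

theorem ae_radialMeasure_pos (α : ℝ) : ∀ᵐ r ∂radialMeasure α, 0 < r :=
  (withDensity_absolutelyContinuous _ _).ae_le (ae_restrict_mem measurableSet_Ioi)

instance sFinite_radialMeasure (α : ℝ) : SFinite (radialMeasure α) := by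
  unfold radialMeasure; infer_instance

/-- The open ray from the origin spanned by a unit vector `u`. -/
def openRay {E : Type*} [NormedAddCommGroup E] [NormedSpace ℝ E] (u : E) : Set E :=
  {x | 0 < ‖x‖ ∧ x = ‖x‖ • u}

/-- The part of the ray of `u` on which the time coordinate `v * ‖x‖ ^ (-α)` is at most `t`. -/
def raySegment {E : Type*} [NormedAddCommGroup E] [NormedSpace ℝ E] (α v : ℝ) (u : E) (t : ℝ) :
    Set E :=
  openRay u ∩ {x | v * ‖x‖ ^ (-α) ≤ t}

variable {d : ℕ} {α : ℝ}

theorem measurableSet_openRay (u : EuclideanSpace ℝ (Fin d)) : MeasurableSet (openRay u) :=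
  (measurableSet_lt measurable_const measurable_norm).inter
    (measurableSet_eq_fun measurable_id (measurable_norm.smul_const u))

theorem measurableSet_raySegment (v : ℝ) (u : EuclideanSpace ℝ (Fin d)) (t : ℝ) :
    MeasurableSet (raySegment α v u t) :=
  (measurableSet_openRay u).inter
    (measurableSet_le ((measurable_norm.pow_const _).const_mul v) measurable_const)

theorem measurable_polar : Measurable fun p : ℝ × sphere (0 : EuclideanSpace ℝ (Fin d)) 1 =>
    p.1 • (p.2 : EuclideanSpace ℝ (Fin d)) :=
  measurable_fst.smul (measurable_subtype_coe.comp measurable_snd)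

theorem smul_mem_openRay_iff {r : ℝ} (hr : 0 < r)
    (x u : sphere (0 : EuclideanSpace ℝ (Fin d)) 1) :
    r • (x : EuclideanSpace ℝ (Fin d)) ∈ openRay (u : EuclideanSpace ℝ (Fin d)) ↔ x = u := by
  have hnorm : ‖r • (x : EuclideanSpace ℝ (Fin d))‖ = r := by
    rw [norm_smul, Real.norm_of_nonneg hr.le, norm_eq_of_mem_sphere, mul_one]
  simp only [openRay, Set.mem_ofPred_eq, hnorm, hr, true_and]
  exact ⟨fun h => Subtype.ext (smul_right_injective _ hr.ne' h), fun h => by rw [h]⟩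

theorem intensity_raySegment (hα : 0 < α) (ν : Measure (sphere (0 : EuclideanSpace ℝ (Fin d)) 1))
    [IsFiniteMeasure ν] {u : sphere (0 : EuclideanSpace ℝ (Fin d)) 1} (hu : 0 < ν {u}) (n : ℕ) :
    intensity α ν (raySegment α (ν.real {u}) u n) = n := by
  have hv : 0 < ν.real {u} := ENNReal.toReal_pos hu.ne' (measure_ne_top _ _)
  have hprod : intensity α ν (raySegment α (ν.real {u}) u n) =
      (radialMeasure α).prod ν
        ({r | 0 < r ∧ ν.real {u} * r ^ (-α) ≤ n} ×ˢ {u}) := by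
    rw [intensity, Measure.map_apply measurable_polar (measurableSet_raySegment _ _ _)]
    refine measure_congr ?_
    filter_upwards [Measure.quasiMeasurePreserving_fst.ae (ae_radialMeasure_pos α)] with p hp
    have hnorm : ‖p.1 • (p.2 : EuclideanSpace ℝ (Fin d))‖ = p.1 := by
      rw [norm_smul, Real.norm_of_nonneg hp.le, norm_eq_of_mem_sphere, mul_one]
    refine propext ?_
    change (p.1 • (p.2 : EuclideanSpace ℝ (Fin d)) ∈ openRay (u : EuclideanSpace ℝ (Fin d)) ∧
      ν.real {u} * ‖p.1 • (p.2 : EuclideanSpace ℝ (Fin d))‖ ^ (-α) ≤ n) ↔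
      ((0 < p.1 ∧ ν.real {u} * p.1 ^ (-α) ≤ n) ∧ p.2 = u)
    rw [smul_mem_openRay_iff hp, hnorm]
    tauto
  rw [hprod, Measure.prod_prod]
  rcases Nat.eq_zero_or_pos n with rfl | hn
  · have : {r : ℝ | 0 < r ∧ ν.real {u} * r ^ (-α) ≤ ((0 : ℕ) : ℝ)} = ∅ := by
      refine Set.eq_empty_of_forall_notMem fun r hr => ?_
      have h1 := mul_pos hv (Real.rpow_pos_of_pos hr.1 (-α))
      have h2 := hr.2
      rw [Nat.cast_zero] at h2
      linarith
    rw [this]; simp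
  · have hn' : (0 : ℝ) < n := by exact_mod_cast hn
    rw [radialMeasure_setOf_le hα hv hn', ← ofReal_measureReal (μ := ν) (s := {u}),
      ← ENNReal.ofReal_mul (div_pos hn' hv).le, div_mul_cancel₀ _ hv.ne', ENNReal.ofReal_natCast]

theorem intensity_compl_iUnion_openRay {l : ℕ}
    (ν : Measure (sphere (0 : EuclideanSpace ℝ (Fin d)) 1)) [IsFiniteMeasure ν]
    {e : Fin l → sphere (0 : EuclideanSpace ℝ (Fin d)) 1} (hsupp : ν (Set.range e)ᶜ = 0) :
    intensity α ν (⋃ i, openRay (e i : EuclideanSpace ℝ (Fin d)))ᶜ = 0 := by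
  rw [intensity, Measure.map_apply measurable_polar
    (MeasurableSet.iUnion fun i => measurableSet_openRay _).compl]
  have h1 : ∀ᵐ p ∂(radialMeasure α).prod ν, 0 < p.1 :=
    Measure.quasiMeasurePreserving_fst.ae (ae_radialMeasure_pos α)
  have h2 : ∀ᵐ p ∂(radialMeasure α).prod ν, p.2 ∈ Set.range e :=
    Measure.quasiMeasurePreserving_snd.ae (p := fun x => x ∈ Set.range e) (mem_ae_iff.2 hsupp)
  refine measure_eq_zero_iff_ae_notMem.2 ?_
  filter_upwards [h1, h2] with p hp1 ⟨i, hi⟩ hmem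
  exact hmem (Set.mem_iUnion.2 ⟨i, (smul_mem_openRay_iff hp1 _ _).2 hi.symm⟩)

/-- The points on a ray, listed by decreasing norm: their time coordinates `v * ‖x‖ ^ (-α)` satisfy
the law of the iterated logarithm. -/
theorem exists_arrival_times (hα : 0 < α) {v : ℝ} (hv : 0 < v)
    {u : EuclideanSpace ℝ (Fin d)} {S : Set (EuclideanSpace ℝ (Fin d))}
    (hfin : ∀ n : ℕ, (S ∩ raySegment α v u n).Finite)
    (hcount : (fun n : ℕ => ((S ∩ raySegment α v u n).ncard : ℝ) - n)
      =O[atTop] fun n : ℕ => lilScale n) :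
    ∃ Γ : ℕ → ℝ, StrictMono Γ ∧ (∀ n, 0 < Γ n) ∧
      (fun n : ℕ => Γ n - n) =O[atTop] (fun n : ℕ => lilScale n) ∧
      S ∩ openRay u = Set.range fun n => Γ n ^ (-(1 / α)) • v ^ (1 / α) • u := by
  set τ : EuclideanSpace ℝ (Fin d) → ℝ := fun x => v * ‖x‖ ^ (-α) with hτ
  have hinv : ∀ x ∈ openRay u, x = τ x ^ (-(1 / α)) • v ^ (1 / α) • u := fun x hx => by
    obtain ⟨h0, hx⟩ := hx
    have h1 : τ x ^ (-(1 / α)) * v ^ (1 / α) = ‖x‖ := by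
      rw [hτ, Real.mul_rpow hv.le (Real.rpow_nonneg h0.le _), ← Real.rpow_mul h0.le,
        mul_right_comm, ← Real.rpow_add hv, neg_add_cancel, Real.rpow_zero, one_mul, neg_mul_neg,
        mul_one_div_cancel hα.ne', Real.rpow_one]
    rw [smul_smul, h1]
    exact hx
  have hτinj : Set.InjOn τ (openRay u) := fun x hx y hy h => by
    rw [hinv x hx, hinv y hy, h]
  have himage : ∀ n : ℕ, τ '' (S ∩ openRay u) ∩ Set.Iic (n : ℝ) =
      τ '' (S ∩ raySegment α v u n) := by
    intro n
    ext t
    constructor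
    · rintro ⟨⟨x, hx, rfl⟩, ht⟩
      exact ⟨x, ⟨hx.1, hx.2, ht⟩, rfl⟩
    · rintro ⟨x, hx, rfl⟩
      exact ⟨⟨x, ⟨hx.1, hx.2.1⟩, rfl⟩, hx.2.2⟩
  have hpos : ∀ t ∈ τ '' (S ∩ openRay u), 0 < t := by
    rintro _ ⟨x, hx, rfl⟩
    exact mul_pos hv (Real.rpow_pos_of_pos hx.2.1 _)
  obtain ⟨Γ, hmono, hrange, hO⟩ := exists_strictMono_range_eq_of_count hpos
    (fun n => by rw [himage]; exact (hfin n).image _) (by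
      refine hcount.congr_left fun n => ?_
      rw [himage, (hτinj.mono fun x hx => hx.2.1).ncard_image])
  refine ⟨Γ, hmono, fun n => hpos _ (hrange ▸ ⟨n, rfl⟩), hO, ?_⟩
  have hcomp : (fun n => Γ n ^ (-(1 / α)) • v ^ (1 / α) • u) =
      (fun t : ℝ => t ^ (-(1 / α)) • v ^ (1 / α) • u) ∘ Γ := rfl
  rw [hcomp, Set.range_comp, hrange, Set.image_image]
  ext x
  constructor
  · exact fun hx => ⟨x, hx, (hinv x hx.2).symm⟩
  · rintro ⟨y, hy, rfl⟩
    change τ y ^ (-(1 / α)) • v ^ (1 / α) • u ∈ S ∩ openRay u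
    rwa [← hinv y hy.2]

/-- Vectors that generate the whole space as a cone have a vanishing linear combination with
positive coefficients. -/
theorem exists_pos_sum_smul_eq_zero {E ι : Type*} [AddCommGroup E] [Module ℝ E] [Fintype ι]
    {u : ι → E} (h : PointedCone.hull ℝ (Set.range u) = ⊤) :
    ∃ w : ι → ℝ, (∀ i, 0 < w i) ∧ ∑ i, w i • u i = 0 := by
  have hmem : -∑ i, u i ∈ PointedCone.hull ℝ (Set.range u) := h ▸ Submodule.mem_top
  obtain ⟨c, hc⟩ := (Submodule.mem_span_range_iff_exists_fun _).1 hmem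
  refine ⟨fun i => 1 + c i, fun i => by have := (c i).2; positivity, ?_⟩
  have hc' : ∑ i, (c i : ℝ) • u i = -∑ i, u i := hc
  simp only [add_smul, one_smul, Finset.sum_add_distrib, hc', add_neg_cancel]

end Intensity

end Peeling

/-! ### The limit of the peels of the Poisson process -/

theorem theorem1 {d l : ℕ} {α : ℝ} (hα : 0 < α)
    (ν : Measure (sphere (0 : EuclideanSpace ℝ (Fin d)) 1)) [IsFiniteMeasure ν]
    (e : Fin l → sphere (0 : EuclideanSpace ℝ (Fin d)) 1) (he : Function.Injective e)
    (hatom : ∀ i, 0 < ν {e i}) (hsupp : ν (Set.range e)ᶜ = 0)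
    (hcone : PointedCone.hull ℝ (Set.range fun i => (e i : EuclideanSpace ℝ (Fin d))) = ⊤)
    (hext : Peeling.IsExtremeSet (Peeling.scaledAtoms α ν e))
    {Ω : Type*} [MeasurableSpace Ω] (P : Measure Ω) [IsProbabilityMeasure P]
    (π : Ω → Set (EuclideanSpace ℝ (Fin d)))
    (hπ : Peeling.IsPoissonPointProcess (Peeling.intensity α ν) π P) :
    (∀ᵐ ω ∂P,
      (∀ᶠ k : ℕ in atTop, hausdorffEDist ((k : ℝ) ^ (1 / α) • Peeling.peel (π ω) k)
        (convexHull ℝ (Peeling.scaledAtoms α ν e)) ≠ ∞) ∧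
      (fun k : ℕ => hausdorffDist ((k : ℝ) ^ (1 / α) • Peeling.peel (π ω) k)
        (convexHull ℝ (Peeling.scaledAtoms α ν e)))
        =O[atTop] fun k : ℕ => √(Real.log (Real.log k) / k)) ∧
    Peeling.IsLimitShape P (fun k ω => Peeling.peel (π ω) k)
      (Peeling.normalize (convexHull ℝ (Peeling.scaledAtoms α ν e))) := by
  set v : Fin l → ℝ := fun i => ν.real {e i} with hvdef
  have hv : ∀ i, 0 < v i := fun i => ENNReal.toReal_pos (hatom i).ne' (measure_ne_top _ _)
  set a : Fin l → EuclideanSpace ℝ (Fin d) :=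
    fun i => v i ^ (1 / α) • (e i : EuclideanSpace ℝ (Fin d)) with hadef
  have hvα : ∀ i, 0 < v i ^ (1 / α) := fun i => Real.rpow_pos_of_pos (hv i) _
  have hA : Peeling.scaledAtoms α ν e = Set.range a := rfl
  have hnorm : ∀ i, ‖(e i : EuclideanSpace ℝ (Fin d))‖ = 1 := fun i => norm_eq_of_mem_sphere _
  have hne : Nonempty (Fin l) := by
    by_contra h
    rw [not_nonempty_iff] at h
    have := hext.2.1
    rw [hA, Set.range_eq_empty, Set.ncard_empty] at this
    omega
  have ha : ∀ i, a i ≠ 0 := fun i => smul_ne_zero (hvα i).ne' (by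
    rw [← norm_ne_zero_iff, hnorm]; exact one_ne_zero)
  obtain ⟨w, hw, hwe⟩ := Peeling.exists_pos_sum_smul_eq_zero hcone
  have hwa : ∑ i, (w i / v i ^ (1 / α)) • a i = 0 := by
    rw [← hwe]
    refine Finset.sum_congr rfl fun i _ => ?_
    rw [hadef, smul_smul, div_mul_cancel₀ _ (hvα i).ne']
  have hray : ∀ i j : Fin l, ∀ s t : ℝ, 0 < s → 0 < t → s • a i = t • a j → i = j := by
    intro i j s t hs ht h
    simp only [hadef, smul_smul] at h
    have h1 : s * v i ^ (1 / α) = t * v j ^ (1 / α) := by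
      have := congrArg norm h
      rwa [norm_smul, norm_smul, hnorm, hnorm, mul_one, mul_one,
        Real.norm_of_nonneg (mul_pos hs (hvα i)).le,
        Real.norm_of_nonneg (mul_pos ht (hvα j)).le] at this
    rw [h1] at h
    exact he (Subtype.ext (smul_right_injective _ (mul_pos ht (hvα j)).ne' h))
  have hexti : ∀ i, a i ∈ (convexHull ℝ (Set.range a)).extremePoints ℝ := fun i => by
    rw [← hA, hext.2.2]
    exact ⟨i, rfl⟩
  have hmain : ∀ᵐ ω ∂P, ((∀ᶠ k : ℕ in atTop, hausdorffEDist ((k : ℝ) ^ (1 / α) •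
      Peeling.peel (π ω) k) (convexHull ℝ (Set.range a)) ≠ ∞) ∧
      (fun k : ℕ => hausdorffDist ((k : ℝ) ^ (1 / α) • Peeling.peel (π ω) k)
        (convexHull ℝ (Set.range a)))
        =O[atTop] fun k : ℕ => √(Real.log (Real.log k) / k)) ∧
      Tendsto (fun k => hausdorffEDist (Peeling.normalize (Peeling.peel (π ω) k))
        (Peeling.normalize (convexHull ℝ (Set.range a)))) atTop (𝓝 0) := by
    -- on each ray the time coordinate turns the intensity into Lebesgue measure on `(0, ∞)`
    have hcount : ∀ i, ∀ᵐ ω ∂P,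
        (∀ n : ℕ, (π ω ∩ Peeling.raySegment α (v i) (e i) n).Finite) ∧
        (fun n : ℕ => ((π ω ∩ Peeling.raySegment α (v i) (e i) n).ncard : ℝ) - n)
          =O[atTop] fun n : ℕ => Peeling.lilScale n := fun i => by
      refine hπ.ae_ncard_sub_isBigO (B := fun n : ℕ => Peeling.raySegment α (v i) (e i) n)
        (fun n => Peeling.measurableSet_raySegment _ _ _) (fun m n hmn => ?_)
        (fun n => Peeling.intensity_raySegment hα ν (hatom i) n) ?_
      · exact Set.inter_subset_inter_right _ fun x hx =>
          (show v i * ‖x‖ ^ (-α) ≤ m from hx).trans (Nat.cast_le.2 hmn)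
      · refine Set.eq_empty_of_forall_notMem fun x hx => ?_
        have h1 := mul_pos (hv i) (Real.rpow_pos_of_pos hx.1.1 (-α))
        have h2 : v i * ‖x‖ ^ (-α) ≤ ((0 : ℕ) : ℝ) := hx.2
        rw [Nat.cast_zero] at h2
        linarith
    filter_upwards [ae_all_iff.2 hcount, hπ.ae_subset
      (MeasurableSet.iUnion fun i => Peeling.measurableSet_openRay _)
      (Peeling.intensity_compl_iUnion_openRay ν hsupp)] with ω hω hsub
    choose Γ hmono hpos hO hrange using fun i =>
      Peeling.exists_arrival_times hα (hv i) (hω i).1 (hω i).2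
    refine Peeling.peel_isBigO_and_tendsto_normalize (fun i => div_pos (hw i) (hvα i)) hwa ha hray
      hexti (one_div_pos.2 hα) hmono hpos hO ?_
    rw [← Set.inter_eq_left.2 hsub, Set.inter_iUnion]
    ext x
    simp only [hrange, Set.mem_iUnion, Set.mem_range, Prod.exists]
    rfl
  exact ⟨hmain.mono fun ω h => h.1, hmain.mono fun ω h => h.2⟩
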